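/- For a commutative ring $R$ that is finitely generated and free as a module over $\mathbb{Z}$ or over $\mathbb{Z}_{(p)}=\{a/b\mid a,b\in\mathbb{Z},\ p\nmid b\}$ ($p$ a prime), call an ideal $I$ of $R$ full if every $r\in R$ has a nonzero integral multiple in $I$, and let $$\zeta_R(s)=\sum_{I}|R:I|^{-s}=\sum_{n\ge1}a_n n^{-s},$$ where $I$ runs through the full ideals of $R$ and $a_n$ is the number of full ideals of index $n$. (1) Let $p$ be a prime. For $a\in\mathbb{Z}_{(p)}$, $a\neq0$, let $[a]$ be the integer $r\ge0$ with $a\mathbb{Z}_{(p)}=p^r\mathbb{Z}_{(p)}$, and let $[0]=\infty$. Let $\alpha,\beta$ be integers with $([\alpha],[\beta],[\beta-\alpha])=(1,1,2)$, and let $$R=\mathbb{Z}_{(p)}[t]/\bigl(t(t-\alpha)(t-\beta)\bigr).$$ Then every full ideal of $R$ has finite index, there are only finitely many of each index, and with $x=p^{-s}$ $$(1-x)^3\zeta_R(s)=p^4x^8-2p^3x^7+(p^3+p^2)x^6+(p^3-2p^2)x^5+px^4+(p^2-2p)x^3+(p+1)x^2-2x+1 .$$ This holds as an identity of formal Dirichlet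 series, and as an identity of complex numbers for $\operatorname{Re}s>0$, where the series $\zeta_R(s)$ converges absolutely. (2) Let $B\in M_4(\mathbb{Z})$ be the adjacency matrix of the cycle of length $4$ and let $\langle B\rangle=\{f(B)\mid f\in\mathbb{Z}[t]\}$. Then every full ideal of $\langle B\rangle$ has finite index, there are only finitely many of each index, and $$\zeta_{\langle B\rangle}(s)=\bigl(16\cdot2^{-8s}-16\cdot2^{-7s}+12\cdot2^{-6s}+2\cdot2^{-4s}+3\cdot2^{-2s}-2\cdot2^{-s}+1\bigr)\,\zeta(s)^3,$$ where $\zeta(s)$ is the Riemann zeta function. This holds as an identity of formal Dirichlet series, and as an identity of complex numbers for $\operatorname{Re}s>1$, where the series $\zeta_{\langle B\rangle}(s)$ converges absolutely. (The factor in parentheses is the polynomial of (1) for $p=2$, $x=2^{-s}$.) -/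

import Mathlib

open Polynomial

noncomputable section

/-! ### Zeta functions counting ideals -/

/-- An ideal `I` of a ring `R` (a `ℤ`-order or a `ℤ_(p)`-order in a `ℚ`-algebra `A`) is full
if it spans `A` over `ℚ`, that is, if every element of `R` has a nonzero integral multiple in `I`. -/
def IsFullIdeal {R : Type*} [CommRing R] (I : Ideal R) : Prop :=
  ∀ r : R, ∃ n : ℕ, n ≠ 0 ∧ n • r ∈ I

/-- The index `|R : I|` of the additive group of `I` in that of `R` (`0` if it is infinite). -/
def idealIndex {R : Type*} [CommRing R] (I : Ideal R) : ℕ :=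
  I.toAddSubgroup.index

/-- The full ideals of `R` of index `n`. -/
def fullIdealsOfIndex (R : Type*) [CommRing R] (n : ℕ) : Set (Ideal R) :=
  {I | IsFullIdeal I ∧ idealIndex I = n}

/-- The series `∑_I |R : I|^{-s}` over the full ideals of `R` makes sense: every full ideal has
finite index, and there are only finitely many full ideals of any given finite index. -/
def IdealZetaWellDefined (R : Type*) [CommRing R] : Prop :=
  (∀ I : Ideal R, IsFullIdeal I → idealIndex I ≠ 0) ∧
    ∀ n : ℕ, n ≠ 0 → (fullIdealsOfIndex R n).Finite

/-- The zeta function `ζ_R(s) = ∑_I |R : I|^{-s} = ∑_{n ≥ 1} a_n n^{-s}` as a formal Dirichlet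
series, given by its coefficients: `a_n` is the number of full ideals of index `n`.
Addition and multiplication of formal Dirichlet series are those of `ArithmeticFunction ℤ`
(multiplication is Dirichlet convolution). -/
def idealZeta (R : Type*) [CommRing R] : ArithmeticFunction ℤ where
  toFun n := if n = 0 then 0 else ((fullIdealsOfIndex R n).ncard : ℤ)
  map_zero' := if_pos rfl

/-- The formal Dirichlet series `m^{-s}` for `m ≥ 1` (coefficient `1` at `m`, all others `0`). -/
def dirichletMonomial (m : ℕ) : ArithmeticFunction ℤ where
  toFun n := if n ≠ 0 ∧ n = m then 1 else 0
  map_zero' := by simp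

/-! ### The localized ring -/

instance isPrime_span_natPrime (p : ℕ) [hp : Fact p.Prime] :
    (Ideal.span {(p : ℤ)}).IsPrime :=
  (Ideal.span_singleton_prime (Int.natCast_ne_zero.mpr hp.out.ne_zero)).mpr
    (Nat.prime_iff_prime_int.mp hp.out)

/-- The localization `{a / b | a, b ∈ ℤ, p ∤ b}` of `ℤ` at the prime `p`. -/
abbrev ZLoc (p : ℕ) [Fact p.Prime] : Type :=
  Localization.AtPrime (Ideal.span {(p : ℤ)})

/-- The valuation `[a]` of `a ∈ ℤ_(p)`: the exponent `r` with `a ℤ_(p) = p ^ r ℤ_(p)` if `a ≠ 0`,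
and `[0] = ∞`. It is the largest `r` such that `p ^ r ∣ a`. -/
def bracket (p : ℕ) [Fact p.Prime] (a : ZLoc p) : ℕ∞ :=
  emultiplicity (p : ZLoc p) a

/-- The ring `R = ℤ_(p)[x] / x (x - α) (x - β) ℤ_(p)[x]`. -/
abbrev LocalCubicRing (p : ℕ) [Fact p.Prime] (α β : ℤ) : Type :=
  (ZLoc p)[X] ⧸ Ideal.span {(X * (X - C (α : ZLoc p)) * (X - C (β : ZLoc p)) : (ZLoc p)[X])}

/-! ### The ring generated by an integral matrix -/

/-- The subring `{f(B) | f ∈ ℤ[x]}` of `M_v(ℤ)` generated by `B`. -/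
abbrev MatrixRing {v : ℕ} (B : Matrix (Fin v) (Fin v) ℤ) : Type :=
  Algebra.adjoin ℤ {B}

instance matrixRingCommRing {v : ℕ} (B : Matrix (Fin v) (Fin v) ℤ) : CommRing (MatrixRing B) :=
  open scoped IsMulCommutative in inferInstance

/-- The adjacency matrix of the cycle of length `4`. -/
def fourCycleMatrix : Matrix (Fin 4) (Fin 4) ℤ :=
  (SimpleGraph.cycleGraph 4).adjMatrix ℤ

end

noncomputable section

open scoped ENNReal

/-! ### Indices of ideals -/

section Index

variable {A B : Type*} [CommRing A] [CommRing B]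

/-! Both rings are quotients of `D[X]` by `X (X - α) (X - β)`, with `D` a principal ideal domain in
which `α`, `β`, `β - α` are unit multiples of `π`, `π`, `π ^ 2` for a prime `π`. The ideals to be
counted are the ideals of `D[X]` containing that product, and the linear factors are removed one at
a time.

Let `φ : A → B` be surjective with kernel `(m)`. An ideal `I` has an image `b = φ(I)` and a colon
ideal `J = (I : m)`, and `N(I) = N(b) N(J)` for the index `N`. If `A`, `B` are domains and `b = (φ
l)` is nonzero, the ideals with data `(J, b)` are the `(l + m h) + m J` with `h` modulo `J` and `l +
m h ∈ J` (`tsum_fibre`). For evaluation at `0` their number is `N(E)` if `b ⊆ E` and `0` otherwise,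
where `E` is the image of `J` (`card_linear_congruence`). Summing over `b` splits off one zeta
function of `D` and leaves a sum over `J` weighted by a function of `E`
(`tsum_ideal_linear_factor`). Removing `X - α` from `J` gives a sum over ideals `c`, `b` of `D` and
residues `h` modulo `c` with `b + (β - α) h ∈ c`, where `E = (b - α h, α c, α β)`
(`tsum_ideal_quadratic`).

Only the `π`-parts of `c` and `b` matter: the cases `v(c) = 0, 1, 2, ≥ 3` yield a finite table
(`weight_mul_residueSum`) in which the variables `c` and `b` separate. Single sums are multiples of
the zeta function of `D`, and the polynomial results. As parts prime to `π` are carried along, `D =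
ℤ` needs no Euler product.

Sums are taken in `ℝ≥0∞` with weight `N(I) ^ (-s)`, `s` real, so rearrangement is free; ideals of
infinite index have `idealIndex` equal to `0` and weight `0`. The values for large real `s` then
determine the formal Dirichlet series (`eq_of_hasValue`). -/

/-- The ideal `{q | m * q ∈ I}`. -/
def colonBy (m : A) (I : Ideal A) : Ideal A :=
  Submodule.comap (LinearMap.mulLeft A m) I

theorem mem_colonBy {m q : A} {I : Ideal A} : q ∈ colonBy m I ↔ m * q ∈ I := Iff.rfl

theorem idealIndex_eq_card (I : Ideal A) : idealIndex I = Nat.card (A ⧸ I) := rfl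

theorem idealIndex_comap {φ : A →+* B} (hφ : Function.Surjective φ) (I : Ideal B) :
    idealIndex (I.comap φ) = idealIndex I :=
  AddSubgroup.index_comap_of_surjective I.toAddSubgroup (f := φ.toAddMonoidHom) hφ

theorem idealIndex_top : idealIndex (⊤ : Ideal A) = 1 :=
  AddSubgroup.index_top

/-- In the chain `I ⊆ I + (m) ⊆ A` the upper step has the index of the image. Multiplication by `m`
maps `A` onto `(m)` and pulls `I` back to the colon ideal, which gives the lower step. The
convention `0` for infinite index is compatible with the product. -/
theorem idealIndex_eq_map_mul_colonBy {φ : A →+* B} (hφ : Function.Surjective φ) {m : A}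
    (hm : RingHom.ker φ = Ideal.span {m}) (I : Ideal A) :
    idealIndex I = idealIndex (I.map φ) * idealIndex (colonBy m I) := by
  have h1 : idealIndex (I.map φ) = (I.toAddSubgroup ⊔ (RingHom.ker φ).toAddSubgroup).index := by
    rw [← idealIndex_comap hφ, Ideal.comap_map_of_surjective' φ hφ, ← Submodule.sup_toAddSubgroup]
    rfl
  have h2 : (RingHom.ker φ).toAddSubgroup = (AddMonoidHom.mulLeft m).range := by
    ext x
    rw [hm]
    simp only [Submodule.mem_toAddSubgroup, Ideal.mem_span_singleton, AddMonoidHom.mem_range]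
    exact ⟨fun ⟨y, hy⟩ => ⟨y, hy.symm⟩, fun ⟨y, hy⟩ => ⟨y, hy.symm⟩⟩
  have h3 : idealIndex (colonBy m I) =
      I.toAddSubgroup.relIndex (RingHom.ker φ).toAddSubgroup := by
    rw [h2, ← AddSubgroup.index_comap]
    rfl
  rw [h1, h3, ← AddSubgroup.relIndex_sup_left, mul_comm, sup_comm]
  exact (AddSubgroup.relIndex_mul_index le_sup_right).symm

theorem idealIndex_span_mul [IsDomain A] {e : A} (he : e ≠ 0) (x : A) :
    idealIndex (Ideal.span {e * x}) = idealIndex (Ideal.span {e}) * idealIndex (Ideal.span {x}) := by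
  rw [idealIndex_eq_map_mul_colonBy (Ideal.Quotient.mk_surjective (I := Ideal.span {e}))
    (Ideal.mk_ker) (Ideal.span {e * x})]
  congr 1
  · rw [← idealIndex_comap (Ideal.Quotient.mk_surjective (I := Ideal.span {e})),
      Ideal.comap_map_of_surjective' _ Ideal.Quotient.mk_surjective, Ideal.mk_ker,
      sup_eq_right.mpr]
    exact Ideal.span_singleton_le_span_singleton.mpr (Dvd.intro x rfl)
  · congr 1
    ext q
    rw [mem_colonBy, Ideal.mem_span_singleton, Ideal.mem_span_singleton]
    exact mul_dvd_mul_iff_left he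

end Index

/-! ### Ideals with prescribed image and colon ideal -/

section Fibre

variable {A B : Type*} [CommRing A] [CommRing B]

/-- The ideal generated by `g` and `m * J`. -/
def extendIdeal (m g : A) (J : Ideal A) : Ideal A :=
  Ideal.span {g} ⊔ Submodule.map (LinearMap.mulLeft A m) J

theorem mem_extendIdeal {m g x : A} {J : Ideal A} :
    x ∈ extendIdeal m g J ↔ ∃ r, ∃ j ∈ J, r * g + m * j = x := by
  rw [extendIdeal, Submodule.mem_sup]
  constructor
  · rintro ⟨y, hy, z, ⟨j, hj, rfl⟩, rfl⟩
    obtain ⟨r, rfl⟩ := Ideal.mem_span_singleton'.mp hy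
    exact ⟨r, j, hj, rfl⟩
  · rintro ⟨r, j, hj, rfl⟩
    exact ⟨r * g, Ideal.mem_span_singleton'.mpr ⟨r, rfl⟩, m * j, ⟨j, hj, rfl⟩, rfl⟩

theorem map_extendIdeal {φ : A →+* B} {m : A} (hm : φ m = 0) (g : A) (J : Ideal A) :
    (extendIdeal m g J).map φ = Ideal.span {φ g} := by
  apply le_antisymm
  · rw [Ideal.map_le_iff_le_comap]
    intro x hx
    obtain ⟨r, j, -, rfl⟩ := mem_extendIdeal.mp hx
    rw [Ideal.mem_comap, map_add, map_mul, map_mul, hm, zero_mul, add_zero]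
    exact Ideal.mul_mem_left _ _ (Ideal.mem_span_singleton_self _)
  · rw [Ideal.span_singleton_le_iff_mem]
    exact Ideal.mem_map_of_mem φ (mem_extendIdeal.mpr ⟨1, 0, J.zero_mem, by ring⟩)

/-- Subtracting a multiple of `g` from an element of `I` leads into `I ∩ (m) = m (I : m)`. -/
theorem eq_extendIdeal {φ : A →+* B} (hφ : Function.Surjective φ) {m : A}
    (hm : RingHom.ker φ = Ideal.span {m}) {g : A} {I : Ideal A} (hg : g ∈ I)
    (hI : I.map φ = Ideal.span {φ g}) : I = extendIdeal m g (colonBy m I) := by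
  apply le_antisymm
  · intro f hf
    have h1 := Ideal.mem_map_of_mem φ hf
    rw [hI] at h1
    obtain ⟨r, hr⟩ := Ideal.mem_span_singleton'.mp h1
    obtain ⟨r, rfl⟩ := hφ r
    have h2 : f - r * g ∈ RingHom.ker φ := by
      rw [RingHom.mem_ker, map_sub, map_mul, hr, sub_self]
    rw [hm] at h2
    obtain ⟨q, hq⟩ := Ideal.mem_span_singleton.mp h2
    refine mem_extendIdeal.mpr ⟨r, q, ?_, by rw [← hq]; ring⟩
    rw [mem_colonBy, ← hq]
    exact I.sub_mem hf (I.mul_mem_left _ hg)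
  · intro x hx
    obtain ⟨r, j, hj, rfl⟩ := mem_extendIdeal.mp hx
    exact I.add_mem (I.mul_mem_left _ hg) hj

theorem tsum_eq_tsum_fibre {φ : A →+* B} (hφ : Function.Surjective φ) {m : A}
    (hm : RingHom.ker φ = Ideal.span {m}) (W : ℕ →*₀ ℝ≥0∞) (Φ : Ideal A → ℝ≥0∞) :
    ∑' I : Ideal A, W (idealIndex I) * Φ I =
      ∑' J : Ideal A, ∑' b : Ideal B, W (idealIndex b) * W (idealIndex J) *
        ∑' I : {I : Ideal A // colonBy m I = J ∧ I.map φ = b}, Φ I := by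
  rw [← ENNReal.tsum_fiberwise _ (fun I : Ideal A => (colonBy m I, I.map φ)), ENNReal.tsum_prod']
  refine tsum_congr fun J => tsum_congr fun b => ?_
  rw [← ENNReal.tsum_mul_left]
  have hs : (fun I : Ideal A => (colonBy m I, I.map φ)) ⁻¹' {(J, b)} =
      {I | colonBy m I = J ∧ I.map φ = b} := by
    ext; simp
  rw [hs]
  refine tsum_congr fun I => ?_
  obtain ⟨I, h1, h2⟩ := I
  simp only
  rw [idealIndex_eq_map_mul_colonBy hφ hm I, map_mul, h1, h2]

variable [IsDomain A] [IsDomain B]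

theorem colonBy_extendIdeal {φ : A →+* B} {m : A} (hm0 : m ≠ 0)
    (hm : RingHom.ker φ = Ideal.span {m}) {g : A} (hg : φ g ≠ 0) {J : Ideal A} (hJ : g ∈ J) :
    colonBy m (extendIdeal m g J) = J := by
  have hφm : φ m = 0 := by
    rw [← RingHom.mem_ker, hm]; exact Ideal.mem_span_singleton_self m
  ext q
  rw [mem_colonBy, mem_extendIdeal]
  constructor
  · rintro ⟨r, j, hj, h⟩
    have h1 : φ r = 0 := by
      have := congrArg φ h
      simp only [map_add, map_mul, hφm, zero_mul, add_zero, mul_eq_zero, hg, or_false] at this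
      exact this
    rw [← RingHom.mem_ker, hm] at h1
    obtain ⟨r', rfl⟩ := Ideal.mem_span_singleton.mp h1
    -- Since `φ g ≠ 0`, the coefficient of `g` is a multiple of `m`, and `m` cancels; the hypothesis
    -- `g ∈ J` then finishes.
    have h2 : q = r' * g + j := mul_left_cancel₀ hm0 (by rw [← h]; ring)
    rw [h2]
    exact J.add_mem (J.mul_mem_left _ hJ) hj
  · intro hq
    exact ⟨0, q, hq, by ring⟩

theorem extendIdeal_injective_mod {φ : A →+* B} {m : A} (hm0 : m ≠ 0)
    (hm : RingHom.ker φ = Ideal.span {m}) {l h h' : A} (hl : φ l ≠ 0) {J : Ideal A}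
    (hJ : l + m * h ∈ J) (he : extendIdeal m (l + m * h) J = extendIdeal m (l + m * h') J) :
    h - h' ∈ J := by
  have hφm : φ m = 0 := by
    rw [← RingHom.mem_ker, hm]; exact Ideal.mem_span_singleton_self m
  rw [← colonBy_extendIdeal hm0 hm (g := l + m * h) (by simpa [hφm]) hJ, mem_colonBy, mul_sub]
  have h1 : l + m * h ∈ extendIdeal m (l + m * h) J :=
    mem_extendIdeal.mpr ⟨1, 0, J.zero_mem, by ring⟩
  have h2 : l + m * h' ∈ extendIdeal m (l + m * h) J := by
    rw [he]; exact mem_extendIdeal.mpr ⟨1, 0, J.zero_mem, by ring⟩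
  have := Ideal.sub_mem _ h1 h2
  rwa [add_sub_add_left_eq_sub] at this

open Classical in
-- A lift of `φ l` to `I` has the form `l + m h`, with `h` unique modulo `J`. The representatives
-- `rep` are left abstract so that constants can serve when `J` is pulled back from `D`.
theorem tsum_fibre {φ : A →+* B} (hφ : Function.Surjective φ) {m : A} (hm0 : m ≠ 0)
    (hm : RingHom.ker φ = Ideal.span {m}) {l : A} (hl : φ l ≠ 0) (J : Ideal A)
    {T : Type*} (rep : T → A) (hrep : ∀ f, ∃! t, f - rep t ∈ J) (Φ : Ideal A → ℝ≥0∞) :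
    ∑' I : {I : Ideal A // colonBy m I = J ∧ I.map φ = Ideal.span {φ l}}, Φ I =
      ∑' t : T, if l + m * rep t ∈ J then Φ (extendIdeal m (l + m * rep t) J) else 0 := by
  have hφm : φ m = 0 := by
    rw [← RingHom.mem_ker, hm]; exact Ideal.mem_span_singleton_self m
  have hφg (h : A) : φ (l + m * h) = φ l := by simp [hφm]
  let e : {t : T // l + m * rep t ∈ J} →
      {I : Ideal A // colonBy m I = J ∧ I.map φ = Ideal.span {φ l}} := fun t =>
    ⟨extendIdeal m (l + m * rep t) J, colonBy_extendIdeal hm0 hm (by rwa [hφg]) t.2,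
      by rw [map_extendIdeal hφm, hφg]⟩
  have he : Function.Bijective e := by
    constructor
    · intro t t' h
      have h1 := extendIdeal_injective_mod hm0 hm hl t.2 (congrArg Subtype.val h)
      exact Subtype.ext ((hrep (rep t)).unique (by simp) h1)
    · rintro ⟨I, hIJ, hI⟩
      have h1 : φ l ∈ I.map φ := hI ▸ Ideal.mem_span_singleton_self _
      obtain ⟨g, hg, hgl⟩ := (Ideal.mem_map_iff_of_surjective φ hφ).mp h1
      have h2 : g - l ∈ RingHom.ker φ := by rw [RingHom.mem_ker, map_sub, hgl, sub_self]
      rw [hm] at h2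
      obtain ⟨h, hh⟩ := Ideal.mem_span_singleton.mp h2
      obtain ⟨t, ht, -⟩ := hrep h
      have h3 : l + m * rep t ∈ I := by
        rw [← hIJ, mem_colonBy] at ht
        have : l + m * rep t = g - m * (h - rep t) := by rw [mul_sub, ← hh]; ring
        rw [this]
        exact I.sub_mem hg ht
      refine ⟨⟨t, ?_⟩, Subtype.ext ?_⟩
      · rw [← hIJ, mem_colonBy]
        exact I.mul_mem_left _ h3
      · have := eq_extendIdeal hφ hm h3 (by rw [hφg]; exact hI)
        rw [hIJ] at this
        exact this.symm
  rw [← (Equiv.ofBijective e he).tsum_eq]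
  have := tsum_subtype {t : T | l + m * rep t ∈ J}
    (fun t => Φ (extendIdeal m (l + m * rep t) J))
  simp only [Set.indicator, Set.mem_ofPred_eq] at this
  exact this

end Fibre

/-! ### Sums over residue classes -/

section Residue

variable {A : Type*} [CommRing A]

theorem existsUnique_sub_out_mem (J : Ideal A) (f : A) :
    ∃! t : A ⧸ J, f - Quotient.out t ∈ J := by
  have key (t : A ⧸ J) : f - Quotient.out t ∈ J ↔ Ideal.Quotient.mk J f = t := by
    rw [← Ideal.Quotient.eq]
    have : Ideal.Quotient.mk J (Quotient.out t) = t := Quotient.out_eq' t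
    rw [this]
  exact ⟨Ideal.Quotient.mk J f, (key _).mpr rfl, fun t ht => ((key t).mp ht).symm⟩

end Residue

/-! ### Counting with a linear congruence -/

section Count

variable {A B : Type*} [CommRing A] [CommRing B]

theorem finite_quotient_of_idealIndex_ne_zero {J : Ideal A} (h : idealIndex J ≠ 0) :
    Finite (A ⧸ J) := Nat.finite_of_card_ne_zero h

open Classical in
-- Multiplication by `m` on the finite group `A ⧸ J` has kernel and cokernel of equal size; the
-- cokernel is `B` modulo the image of `J`, and a nonempty solution set is a coset of the kernel.
theorem card_linear_congruence {φ : A →+* B} (hφ : Function.Surjective φ) {m : A}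
    (hm : RingHom.ker φ = Ideal.span {m}) {J : Ideal A} (hJ : idealIndex J ≠ 0) (l : A) :
    Nat.card {t : A ⧸ J // l + m * Quotient.out t ∈ J} =
      if φ l ∈ J.map φ then idealIndex (J.map φ) else 0 := by
  have := finite_quotient_of_idealIndex_ne_zero hJ
  let μ : A ⧸ J →+ A ⧸ J := AddMonoidHom.mulLeft (Ideal.Quotient.mk J m)
  have hcond (t : A ⧸ J) : l + m * Quotient.out t ∈ J ↔ μ t = - Ideal.Quotient.mk J l := by
    have : Ideal.Quotient.mk J (Quotient.out t) = t := Quotient.out_eq' t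
    rw [← Ideal.Quotient.eq_zero_iff_mem, map_add, map_mul, this, eq_neg_iff_add_eq_zero, add_comm]
    rfl
  have hcomap : (J.map φ).comap φ = J ⊔ Ideal.span {m} := by
    rw [Ideal.comap_map_of_surjective' φ hφ, hm]
  have hrange (x : A) : Ideal.Quotient.mk J x ∈ μ.range ↔ φ x ∈ J.map φ := by
    rw [← Ideal.mem_comap, hcomap, AddMonoidHom.mem_range, sup_comm]
    constructor
    · rintro ⟨t, ht⟩
      obtain ⟨t, rfl⟩ := Ideal.Quotient.mk_surjective t
      have h1 : m * t - x ∈ J := by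
        rw [← Ideal.Quotient.eq, map_mul]; exact ht
      have : x = m * t + -(m * t - x) := by ring
      rw [this]
      exact Submodule.add_mem_sup (Ideal.mul_mem_right _ _ (Ideal.mem_span_singleton_self m))
        (J.neg_mem h1)
    · intro hx
      obtain ⟨y, hy, z, hz, rfl⟩ := Submodule.mem_sup.mp hx
      obtain ⟨t, rfl⟩ := Ideal.mem_span_singleton.mp hy
      refine ⟨Ideal.Quotient.mk J t, ?_⟩
      rw [map_add, Ideal.Quotient.eq_zero_iff_mem.mpr hz, add_zero, map_mul]
      rfl
  have hindex : idealIndex (J.map φ) = μ.range.index := by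
    rw [← idealIndex_comap hφ, ← AddSubgroup.index_comap_of_surjective μ.range
      (f := (Ideal.Quotient.mk J).toAddMonoidHom) Ideal.Quotient.mk_surjective]
    unfold idealIndex
    congr 1
    ext x
    exact (hrange x).symm
  have hker : Nat.card μ.ker = μ.range.index := by
    have h1 := μ.range.card_mul_index
    have h2 := μ.ker.card_mul_index
    rw [AddSubgroup.index_ker, ← h1, mul_comm] at h2
    exact Nat.eq_of_mul_eq_mul_left Nat.card_pos h2
  split_ifs with h
  · rw [hindex, ← hker]
    obtain ⟨t₀, ht₀⟩ := (hrange l).mpr h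
    refine Nat.card_congr ((Equiv.addRight t₀).subtypeEquiv fun t => ?_)
    rw [hcond, Equiv.coe_addRight, AddMonoidHom.mem_ker, map_add, ht₀, eq_neg_iff_add_eq_zero]
  · have : IsEmpty {t : A ⧸ J // l + m * Quotient.out t ∈ J} := by
      refine ⟨fun ⟨t, ht⟩ => h ?_⟩
      rw [← hrange]
      exact ⟨-t, by rw [map_neg, (hcond t).mp ht, neg_neg]⟩
    exact Nat.card_of_isEmpty

theorem tsum_ite_eq_card {T : Type*} [Finite T] (P : T → Prop) [DecidablePred P] (c : ℝ≥0∞) :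
    ∑' t, (if P t then c else 0) = Nat.card {t // P t} * c := by
  have := Fintype.ofFinite T
  rw [tsum_fintype, Finset.sum_ite, Finset.sum_const_zero, add_zero, Finset.sum_const,
    nsmul_eq_mul, Nat.card_eq_fintype_card, Fintype.card_subtype]

end Count

/-! ### Sums over the ideals of a principal ideal domain -/

section PID

variable {D : Type*} [CommRing D]

/-- The sum of a multiplicative weight of the index over all ideals. -/
def idealSum (D : Type*) [CommRing D] (W : ℕ →*₀ ℝ≥0∞) : ℝ≥0∞ :=
  ∑' a : Ideal D, W (idealIndex a)

variable [IsDomain D] [IsPrincipalIdealRing D]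

open Classical in
-- The ideals inside `(e)` are the products `(e) a`, and the index of principal ideals is
-- multiplicative.
theorem tsum_ideal_le (W : ℕ →*₀ ℝ≥0∞) {e : D} (he : e ≠ 0) :
    ∑' a : Ideal D, (if a ≤ Ideal.span {e} then W (idealIndex a) else 0) =
      W (idealIndex (Ideal.span {e})) * idealSum D W := by
  have hinj : Function.Injective (fun a : Ideal D => Ideal.span {e} * a) := fun a b h => by
    exact (Ideal.span_singleton_mul_right_inj he).mp h
  rw [← hinj.tsum_eq, idealSum, ← ENNReal.tsum_mul_left]
  · refine tsum_congr fun a => ?_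
    rw [if_pos Ideal.mul_le_left]
    obtain ⟨x, rfl⟩ := IsPrincipalIdealRing.principal a
    rw [← Ideal.submodule_span_eq, Ideal.submodule_span_eq, Ideal.submodule_span_eq,
      Ideal.span_singleton_mul_span_singleton, idealIndex_span_mul he, map_mul]
  · intro a ha
    have hle : a ≤ Ideal.span {e} := by
      by_contra h
      exact ha (if_neg h)
    obtain ⟨x, rfl⟩ := IsPrincipalIdealRing.principal a
    obtain ⟨y, rfl⟩ := Ideal.span_singleton_le_span_singleton.mp hle
    exact ⟨Ideal.span {y}, by simp [Ideal.span_singleton_mul_span_singleton]⟩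

end PID

/-! ### Ideals of the polynomial ring -/

section Poly

variable {D : Type*} [CommRing D]

theorem evalRingHom_surjective (γ : D) : Function.Surjective (evalRingHom γ) := fun a => ⟨C a, by simp⟩

variable [IsDomain D] [IsPrincipalIdealRing D]

/-- A chosen generator of an ideal. -/
def gen (a : Ideal D) : D := Submodule.IsPrincipal.generator a

omit [IsDomain D] in
theorem span_gen (a : Ideal D) : Ideal.span {gen a} = a := Ideal.span_singleton_generator a

omit [IsDomain D] in
theorem gen_eq_zero {a : Ideal D} : gen a = 0 ↔ a = ⊥ :=
  (Submodule.IsPrincipal.eq_bot_iff_generator_eq_zero a).symm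

/-- The function `E ↦ N(E) W(N(E))` of an ideal, `N` the index. -/
def normWeight (W : ℕ →*₀ ℝ≥0∞) (E : Ideal D) : ℝ≥0∞ := idealIndex E * W (idealIndex E)

open Classical in
-- The fibre over `b ⊆ E` has `N(E)` elements whatever `b` is, so the sum over `b` runs over all
-- ideals below `E` and is `W(N(E))` times the full sum.
theorem tsum_ideal_linear_factor (hbot : idealIndex (⊥ : Ideal D) = 0) (W : ℕ →*₀ ℝ≥0∞) (γ : D)
    (g : D[X]) :
    ∑' I : Ideal D[X], W (idealIndex I) * (if (X - C γ) * g ∈ I then 1 else 0) =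
      idealSum D W * ∑' J : Ideal D[X], W (idealIndex J) *
        (if g ∈ J then normWeight W (J.map (evalRingHom γ)) else 0) := by
  have hker := ker_evalRingHom γ
  rw [tsum_eq_tsum_fibre (evalRingHom_surjective γ) hker, ← ENNReal.tsum_mul_left]
  refine tsum_congr fun J => ?_
  by_cases hJ : idealIndex J = 0
  · simp [hJ]
  by_cases hg : g ∈ J
  swap
  · rw [if_neg hg, mul_zero, mul_zero]
    refine ENNReal.tsum_eq_zero.mpr fun b => ?_
    convert mul_zero _
    refine ENNReal.tsum_eq_zero.mpr fun I => if_neg ?_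
    rw [← mem_colonBy, I.2.1]
    exact hg
  rw [if_pos hg]
  set E := J.map (evalRingHom γ) with hE
  have hE0 : idealIndex E ≠ 0 := by
    rw [idealIndex_eq_map_mul_colonBy (evalRingHom_surjective γ) hker] at hJ
    exact left_ne_zero_of_mul hJ
  have hEbot : E ≠ ⊥ := fun h => hE0 (h ▸ hbot)
  have h1 (b : Ideal D) : W (idealIndex b) * W (idealIndex J) *
      ∑' I : {I : Ideal D[X] // colonBy (X - C γ) I = J ∧ I.map (evalRingHom γ) = b},
        (if (X - C γ) * g ∈ (I : Ideal D[X]) then (1 : ℝ≥0∞) else 0) =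
      W (idealIndex J) * idealIndex E * (if b ≤ Ideal.span {gen E} then W (idealIndex b) else 0) := by
    rw [span_gen]
    by_cases hb : b = ⊥
    · rw [hb, hbot]; simp
    have h2 (I : {I : Ideal D[X] // colonBy (X - C γ) I = J ∧ I.map (evalRingHom γ) = b}) :
        (if (X - C γ) * g ∈ (I : Ideal D[X]) then (1 : ℝ≥0∞) else 0) = 1 := by
      rw [if_pos]
      rw [← mem_colonBy, I.2.1]
      exact hg
    rw [tsum_congr h2]
    have h3 : b = Ideal.span {evalRingHom γ (C (gen b))} := by
      rw [coe_evalRingHom, eval_C, span_gen]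
    have h4 := tsum_fibre (evalRingHom_surjective γ) (X_sub_C_ne_zero γ) hker (l := C (gen b))
      (by rw [coe_evalRingHom, eval_C]; exact mt gen_eq_zero.mp hb) J _
      (existsUnique_sub_out_mem J) (fun _ => 1)
    rw [← h3] at h4
    have := finite_quotient_of_idealIndex_ne_zero hJ
    rw [h4, tsum_ite_eq_card, card_linear_congruence (evalRingHom_surjective γ) hker hJ, ← hE,
      coe_evalRingHom, eval_C, ← Ideal.span_singleton_le_iff_mem, span_gen]
    split_ifs
    · ring
    · simp
  rw [tsum_congr h1, ENNReal.tsum_mul_left, tsum_ideal_le W (mt gen_eq_zero.mp hEbot), span_gen,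
    normWeight]
  ring

end Poly

/-! ### Ideals containing two linear factors -/

section PolyQuadratic

theorem map_extendIdeal_eq_sup {A B : Type*} [CommRing A] [CommRing B] (φ : A →+* B) (m g : A)
    (J : Ideal A) :
    (extendIdeal m g J).map φ = Ideal.span {φ g} ⊔ Ideal.span {φ m} * J.map φ := by
  have : extendIdeal m g J = Ideal.span {g} ⊔ Ideal.span {m} * J := by
    unfold extendIdeal
    congr 1
    ext x
    rw [Ideal.mem_span_singleton_mul]
    rfl
  rw [this, Ideal.map_sup, Ideal.map_mul, Ideal.map_span, Ideal.map_span, Set.image_singleton,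
    Set.image_singleton]

variable {D : Type*} [CommRing D]

theorem map_comap_eval (β γ : D) (c : Ideal D) :
    (c.comap (evalRingHom β)).map (evalRingHom γ) = c ⊔ Ideal.span {γ - β} := by
  apply le_antisymm
  · rw [Ideal.map_le_iff_le_comap]
    intro f hf
    rw [Ideal.mem_comap, coe_evalRingHom] at *
    have : f.eval γ = f.eval β + (f.eval γ - f.eval β) := by ring
    rw [this]
    exact Submodule.add_mem_sup hf (Ideal.mem_span_singleton.mpr (sub_dvd_eval_sub _ _ _))
  · refine sup_le (fun x hx => ?_) ?_
    · have : x = evalRingHom γ (C x) := by simp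
      rw [this]
      exact Ideal.mem_map_of_mem _ (by simpa using hx)
    · rw [Ideal.span_singleton_le_iff_mem]
      have : γ - β = evalRingHom γ (X - C β) := by simp
      rw [this]
      exact Ideal.mem_map_of_mem _ (by simp)

variable [IsDomain D] [IsPrincipalIdealRing D]

/-- The ideal `(b - α h, α c, α β)`, for `γ = 0`. -/
def residueIdeal (α β γ : D) (c : Ideal D) (b h : D) : Ideal D :=
  Ideal.span {b + (γ - α) * h} ⊔ Ideal.span {γ - α} * (c ⊔ Ideal.span {γ - β})

open Classical in
-- The colon ideal by `X - α` contains `X - β`, hence is pulled back from an ideal `c` along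
-- evaluation at `β`. Residues modulo it are represented by constants, and evaluating the membership
-- condition at `β` gives the congruence modulo `c`.
theorem tsum_ideal_quadratic (hbot : idealIndex (⊥ : Ideal D) = 0) (W : ℕ →*₀ ℝ≥0∞) (α β γ : D)
    (F : Ideal D → ℝ≥0∞) :
    ∑' J : Ideal D[X], W (idealIndex J) *
        (if (X - C α) * (X - C β) ∈ J then F (J.map (evalRingHom γ)) else 0) =
      ∑' c : Ideal D, ∑' b : Ideal D, W (idealIndex b) * W (idealIndex c) *
        ∑' t : D ⧸ c, if gen b + (β - α) * Quotient.out t ∈ c then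
          F (residueIdeal α β γ c (gen b) (Quotient.out t)) else 0 := by
  have hker := ker_evalRingHom α
  have hinj : Function.Injective (fun c : Ideal D => c.comap (evalRingHom β)) :=
    Ideal.comap_injective_of_surjective _ (evalRingHom_surjective β)
  rw [tsum_eq_tsum_fibre (evalRingHom_surjective α) hker, ← hinj.tsum_eq]
  · refine tsum_congr fun c => tsum_congr fun b => ?_
    rw [idealIndex_comap (evalRingHom_surjective β)]
    by_cases hb : b = ⊥
    · rw [hb, hbot]; simp
    congr 1
    have h3 : b = Ideal.span {evalRingHom α (C (gen b))} := by
      rw [coe_evalRingHom, eval_C, span_gen]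
    have h4 := tsum_fibre (evalRingHom_surjective α) (X_sub_C_ne_zero α) hker (l := C (gen b))
      (by rw [coe_evalRingHom, eval_C]; exact mt gen_eq_zero.mp hb) (c.comap (evalRingHom β))
      (fun t : D ⧸ c => C (Quotient.out t))
      (fun f => by simpa using existsUnique_sub_out_mem c (f.eval β))
      (fun I => if (X - C α) * (X - C β) ∈ I then F (I.map (evalRingHom γ)) else 0)
    rw [← h3] at h4
    rw [h4]
    refine tsum_congr fun t => ?_
    congr 1
    · simp
    · rw [if_pos (mem_extendIdeal.mpr ⟨0, X - C β, by simp, by ring⟩), map_extendIdeal_eq_sup,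
        map_comap_eval, residueIdeal]
      simp
  · intro K hK
    have hmem : X - C β ∈ K := by
      by_contra h
      refine hK (ENNReal.tsum_eq_zero.mpr fun b => ?_)
      convert mul_zero _
      refine ENNReal.tsum_eq_zero.mpr fun I => if_neg ?_
      rw [← mem_colonBy, I.2.1]
      exact h
    refine ⟨K.map (evalRingHom β), ?_⟩
    simp only
    rw [Ideal.comap_map_of_surjective' _ (evalRingHom_surjective β), ker_evalRingHom, sup_eq_left,
      Ideal.span_singleton_le_iff_mem]
    exact hmem

end PolyQuadratic

/-! ### Residue counts according to the valuation of `c` -/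

section LocalCount

theorem isCoprime_of_isUnit_left {D : Type*} [CommRing D] {u : D} (hu : IsUnit u) (c : D) :
    IsCoprime u c := by
  obtain ⟨u, rfl⟩ := hu
  exact ⟨↑u⁻¹, 0, by simp⟩

theorem exists_congruence_iff {D : Type*} [CommRing D] {c e : D} (h : IsCoprime e c) (x : D) :
    ∃ h₀, ∀ h, c ∣ x + e * h ↔ c ∣ h - h₀ := by
  obtain ⟨r, s, hrs⟩ := h
  refine ⟨-(r * x), fun h => ?_⟩
  have hec : IsCoprime c e := ⟨s, r, by rw [← hrs]; ring⟩
  have h1 : x + e * h = e * (h - -(r * x)) + c * (s * x) := by linear_combination -x * hrs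
  rw [h1, dvd_add_left (Dvd.intro _ rfl)]
  exact ⟨hec.dvd_of_dvd_mul_left, fun h => h.mul_left e⟩

variable {D : Type*} [CommRing D] [IsDomain D]

open Classical in
-- The residues modulo `d * c` congruent to `h₀` modulo `c` are `h₀ + c k` with `k` modulo `d`.
theorem tsum_quotient_congruent {d c : D} (hc : c ≠ 0) (h₀ : D) (φ : D → ℝ≥0∞)
    (hφ : ∀ x y, d * c ∣ x - y → φ x = φ y) :
    ∑' t : D ⧸ Ideal.span {d * c}, (if c ∣ Quotient.out t - h₀ then φ (Quotient.out t) else 0) =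
      ∑' k : D ⧸ Ideal.span {d}, φ (h₀ + c * Quotient.out k) := by
  have hout (e : D) (x : D) :
      e ∣ Quotient.out (Ideal.Quotient.mk (Ideal.span {e}) x) - x := by
    rw [← Ideal.mem_span_singleton, ← Ideal.Quotient.eq]
    exact Quotient.out_eq' _
  have hmk (e : D) (t : D ⧸ Ideal.span {e}) : Ideal.Quotient.mk _ (Quotient.out t) = t :=
    Quotient.out_eq' t
  let g : D ⧸ Ideal.span {d} → D ⧸ Ideal.span {d * c} := fun k =>
    Ideal.Quotient.mk _ (h₀ + c * Quotient.out k)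
  have hg : Function.Injective g := by
    intro k k' h
    have h1 := Ideal.Quotient.eq.mp h
    rw [add_sub_add_left_eq_sub, ← mul_sub, mul_comm d, Ideal.mem_span_singleton,
      mul_dvd_mul_iff_left hc, ← Ideal.mem_span_singleton, ← Ideal.Quotient.eq, hmk, hmk] at h1
    exact h1
  rw [← hg.tsum_eq]
  · refine tsum_congr fun k => ?_
    have h1 := hout (d * c) (h₀ + c * Quotient.out k)
    rw [if_pos, hφ _ _ h1]
    have h2 := dvd_add ((Dvd.intro_left d rfl).trans h1) (Dvd.intro (Quotient.out k) rfl)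
    convert h2 using 1
    simp only [g]
    ring
  · intro t ht
    have h1 : c ∣ Quotient.out t - h₀ := by
      by_contra h
      exact ht (if_neg h)
    obtain ⟨k, hk⟩ := h1
    refine ⟨Ideal.Quotient.mk _ k, ?_⟩
    rw [← hmk _ t]
    refine Ideal.Quotient.eq.mpr (Ideal.mem_span_singleton.mpr ?_)
    have h2 := mul_dvd_mul_right (hout d k) c
    convert h2 using 1
    rw [sub_mul, mul_comm k, ← hk]
    ring

open Classical in
/-- Among the residues `k` modulo `d * π`, the number with `π ∣ x + e k` is `N(d)`. -/
theorem tsum_quotient_ite {π d e : D} (hπ : π ≠ 0) (he : IsCoprime e π) (x : D)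
    (hd : idealIndex (Ideal.span {d}) ≠ 0) (hdπ : idealIndex (Ideal.span {d * π}) ≠ 0)
    (f₁ f₂ : ℝ≥0∞) :
    ∑' k : D ⧸ Ideal.span {d * π}, (if π ∣ x + e * Quotient.out k then f₂ else f₁) =
      idealIndex (Ideal.span {d}) * f₂ +
        (idealIndex (Ideal.span {d * π}) - idealIndex (Ideal.span {d}) : ℕ) * f₁ := by
  obtain ⟨h₀, hh₀⟩ := exists_congruence_iff he x
  simp only [hh₀]
  have := finite_quotient_of_idealIndex_ne_zero hd
  have := finite_quotient_of_idealIndex_ne_zero hdπ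
  have h1 := tsum_quotient_congruent (d := d) hπ h₀ (fun _ => 1) (fun _ _ _ => rfl)
  rw [tsum_ite_eq_card, ENNReal.tsum_const, mul_one, mul_one, ENat.card_eq_coe_natCard] at h1
  have h2 : Nat.card {t : D ⧸ Ideal.span {d * π} // π ∣ Quotient.out t - h₀} =
      idealIndex (Ideal.span {d}) := by exact_mod_cast h1
  have h3 : Nat.card {t : D ⧸ Ideal.span {d * π} // ¬ π ∣ Quotient.out t - h₀} =
      idealIndex (Ideal.span {d * π}) - idealIndex (Ideal.span {d}) := by
    rw [← h2, idealIndex_eq_card, eq_tsub_iff_add_eq_of_le (Finite.card_subtype_le _), add_comm,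
      ← Nat.card_sum]
    exact Nat.card_congr (Equiv.sumCompl _)
  have h4 (k : D ⧸ Ideal.span {d * π}) : (if π ∣ Quotient.out k - h₀ then f₂ else f₁) =
      (if π ∣ Quotient.out k - h₀ then f₂ else 0) +
        (if ¬ π ∣ Quotient.out k - h₀ then f₁ else 0) := by
    split_ifs <;> simp
  rw [tsum_congr h4, ENNReal.tsum_add, tsum_ite_eq_card, tsum_ite_eq_card, h2, h3]

variable [IsPrincipalIdealRing D]

theorem isCoprime_of_prime_of_not_dvd {π c : D} (hπ : Prime π) (h : ¬ π ∣ c) : IsCoprime π c :=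
  (hπ.irreducible.coprime_iff_not_dvd).mpr h

theorem span_sup_span_prime {π : D} (hπ : Prime π) (x : D) [Decidable (π ∣ x)] :
    Ideal.span {x} ⊔ Ideal.span {π} = if π ∣ x then Ideal.span {π} else ⊤ := by
  split_ifs with h
  · exact sup_eq_right.mpr (Ideal.span_singleton_le_span_singleton.mpr h)
  · exact (Ideal.isCoprime_span_singleton_iff x π).mpr
      (isCoprime_of_prime_of_not_dvd hπ h).symm |>.sup_eq

/-- The sum over the residues `h` modulo `c` with `b + (β - α) h ∈ c` of a function of the ideal
`(b - α h, α c, α β)`. -/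
def residueSum (α β : D) (F : Ideal D → ℝ≥0∞) (c : Ideal D) (b : D) : ℝ≥0∞ :=
  open Classical in
  ∑' t : D ⧸ c, if b + (β - α) * Quotient.out t ∈ c then
    F (residueIdeal α β 0 c b (Quotient.out t)) else 0

variable {π u v w : D}

omit [IsDomain D] [IsPrincipalIdealRing D] in
theorem residueIdeal_eq (hu : IsUnit u) (hw : IsUnit w) (c : Ideal D) (b h : D) :
    residueIdeal (π * u) (π * w) 0 c b h =
      Ideal.span {b - π * u * h} ⊔ Ideal.span {π} * (c ⊔ Ideal.span {π}) := by
  obtain ⟨u, rfl⟩ := hu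
  obtain ⟨w, rfl⟩ := hw
  unfold residueIdeal
  rw [zero_sub, zero_sub, Ideal.span_singleton_neg, Ideal.span_singleton_neg,
    Ideal.span_singleton_mul_right_unit u.isUnit, Ideal.span_singleton_mul_right_unit w.isUnit]
  congr 3
  ring

open Classical in
theorem residueIdeal_of_not_dvd (hu : IsUnit u) (hw : IsUnit w) (hπ : Prime π) {c : D}
    (hc : ¬ π ∣ c) (b h : D) :
    residueIdeal (π * u) (π * w) 0 (Ideal.span {c}) b h =
      if π ∣ b then Ideal.span {π} else ⊤ := by
  rw [residueIdeal_eq hu hw, span_sup_span_prime hπ, if_neg hc, Ideal.mul_top,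
    span_sup_span_prime hπ]
  congr 1
  rw [mul_assoc, dvd_sub_left (Dvd.intro _ rfl)]

open Classical in
theorem residueIdeal_of_dvd (hu : IsUnit u) (hw : IsUnit w) (hπ : Prime π) {c : D}
    (hc : π ∣ c) (b h : D) :
    residueIdeal (π * u) (π * w) 0 (Ideal.span {c}) (π * b) h =
      if π ∣ b - u * h then Ideal.span {π ^ 2} else Ideal.span {π} := by
  rw [residueIdeal_eq hu hw, span_sup_span_prime hπ, if_pos hc, mul_assoc, ← mul_sub,
    ← Ideal.span_singleton_mul_span_singleton, ← Ideal.mul_sup, span_sup_span_prime hπ]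
  split_ifs
  · rw [Ideal.span_singleton_mul_span_singleton, sq]
  · rw [Ideal.mul_top]

/-- Here `β - α` is invertible modulo `c`, so there is a single `h`, and `α h`, being divisible by
`π`, does not affect the ideal. -/
theorem residueSum_of_not_dvd (hu : IsUnit u) (hv : IsUnit v) (hw : IsUnit w) (hπ : Prime π)
    (huvw : π * w - π * u = π ^ 2 * v) (F : Ideal D → ℝ≥0∞) {c : D} (hc0 : c ≠ 0)
    (hc : ¬ π ∣ c) (b : D) [Decidable (π ∣ b)] :
    residueSum (π * u) (π * w) F (Ideal.span {c}) b =
      if π ∣ b then F (Ideal.span {π}) else F ⊤ := by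
  classical
  have he : IsCoprime (π ^ 2 * v) c :=
    ((isCoprime_of_prime_of_not_dvd hπ hc).pow_left).mul_left (isCoprime_of_isUnit_left hv c)
  obtain ⟨h₀, hh₀⟩ := exists_congruence_iff he b
  unfold residueSum
  simp only [huvw, Ideal.mem_span_singleton, hh₀, residueIdeal_of_not_dvd hu hw hπ hc]
  have h1 := tsum_quotient_congruent (d := 1) hc0 h₀
    (fun _ => F (if π ∣ b then Ideal.span {π} else ⊤)) (fun _ _ _ => rfl)
  rw [one_mul] at h1
  refine (Eq.trans ?_ h1).trans ?_
  · congr!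
  · have : Finite (D ⧸ Ideal.span {(1 : D)}) :=
      finite_quotient_of_idealIndex_ne_zero (by rw [Ideal.span_singleton_one, idealIndex_top]; simp)
    rw [ENNReal.tsum_const, ENat.card_eq_coe_natCard, ← idealIndex_eq_card,
      Ideal.span_singleton_one, idealIndex_top]
    split_ifs <;> simp

omit [IsDomain D] [IsPrincipalIdealRing D] in
theorem residueSum_eq_zero (huvw : π * w - π * u = π ^ 2 * v) (F : Ideal D → ℝ≥0∞) {d c b : D}
    (hd : d ∣ π ^ 2) (hc : d ∣ c) (hb : ¬ d ∣ b) :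
    residueSum (π * u) (π * w) F (Ideal.span {c}) b = 0 := by
  unfold residueSum
  rw [ENNReal.tsum_eq_zero]
  refine fun t => if_neg fun h => hb ?_
  rw [huvw, Ideal.mem_span_singleton] at h
  exact (dvd_add_left ((hd.mul_right v).mul_right _)).mp (hc.trans h)

open Classical in
-- Common reduction for `π ∣ d`: cancelling `d` in the congruence leaves `h = h₀ + c k` with `k`
-- modulo `d`, and the ideal depends only on `h` modulo `π`.
theorem residueSum_of_dvd (hu : IsUnit u) (hw : IsUnit w) (hπ : Prime π)
    (huvw : π * w - π * u = π ^ 2 * v) (F : Ideal D → ℝ≥0∞) {d c b x h₀ : D} (hc0 : c ≠ 0)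
    (hd0 : d ≠ 0) (hπd : π ∣ d) (hbx : π * b = d * x) 
    {e : D} (hde : π ^ 2 * v = d * e) (hh₀ : ∀ h, c ∣ x + e * h ↔ c ∣ h - h₀) :
    residueSum (π * u) (π * w) F (Ideal.span {d * c}) (π * b) =
      ∑' k : D ⧸ Ideal.span {d}, if π ∣ (b - u * h₀) + (-u * c) * Quotient.out k then
        F (Ideal.span {π ^ 2}) else F (Ideal.span {π}) := by
  have hcond (h : D) : d * c ∣ π * b + d * e * h ↔ c ∣ h - h₀ := by
    rw [hbx, mul_assoc, ← mul_add, mul_dvd_mul_iff_left hd0, hh₀]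
  unfold residueSum
  simp only [huvw, hde, Ideal.mem_span_singleton, hcond,
    residueIdeal_of_dvd hu hw hπ (hπd.mul_right c)]
  have h1 := tsum_quotient_congruent (d := d) hc0 h₀
    (fun h => F (if π ∣ b - u * h then Ideal.span {π ^ 2} else Ideal.span {π})) (fun y z hyz => by
      have : π ∣ b - u * y ↔ π ∣ b - u * z := by
        have h2 : b - u * z = b - u * y + u * (y - z) := by ring
        rw [h2, dvd_add_left (((hπd.mul_right c).trans hyz).mul_left u)]
      simp only [this])
  refine (Eq.trans ?_ h1).trans (tsum_congr fun k => ?_)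
  · congr!
  · have h2 : b - u * (h₀ + c * Quotient.out k) = b - u * h₀ + -u * c * Quotient.out k := by ring
    rw [h2]
    split_ifs <;> rfl

/-- Valuation `1`: as `c` is prime to `π`, the solutions meet each class modulo `π` once, and one
class gives `(π ^ 2)`. -/
theorem residueSum_of_dvd_of_not_sq_dvd (hu : IsUnit u) (hv : IsUnit v) (hw : IsUnit w)
    (hπ : Prime π) (huvw : π * w - π * u = π ^ 2 * v) (F : Ideal D → ℝ≥0∞)
    (hN : idealIndex (Ideal.span {π}) ≠ 0) {c : D}
    (hc0 : c ≠ 0) (hc : ¬ π ∣ c) (b : D) :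
    residueSum (π * u) (π * w) F (Ideal.span {π * c}) (π * b) =
      F (Ideal.span {π ^ 2}) + (idealIndex (Ideal.span {π}) - 1 : ℕ) * F (Ideal.span {π}) := by
  classical
  have hco := isCoprime_of_prime_of_not_dvd hπ hc
  obtain ⟨h₀, hh₀⟩ := exists_congruence_iff (hco.mul_left (isCoprime_of_isUnit_left hv c)) b
  rw [residueSum_of_dvd hu hw hπ huvw F hc0 hπ.ne_zero dvd_rfl rfl (e := π * v) (by ring) hh₀]
  have h1 := tsum_quotient_ite (d := 1) hπ.ne_zero (e := -u * c)
    ((isCoprime_of_isUnit_left hu.neg π).mul_left hco.symm) (b - u * h₀)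
    (by rw [Ideal.span_singleton_one, idealIndex_top]; simp) (by rwa [one_mul])
    (F (Ideal.span {π})) (F (Ideal.span {π ^ 2}))
  rw [one_mul, Ideal.span_singleton_one, idealIndex_top, Nat.cast_one, one_mul] at h1
  exact h1

/-- Valuation `2`: the congruence restricts `h` only modulo the part prime to `π`, so the solutions
are equidistributed modulo `π`. -/
theorem residueSum_of_sq_dvd (hu : IsUnit u) (hv : IsUnit v) (hw : IsUnit w)
    (hπ : Prime π) (huvw : π * w - π * u = π ^ 2 * v) (F : Ideal D → ℝ≥0∞)
    (hN : idealIndex (Ideal.span {π}) ≠ 0) {c : D}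
    (hc0 : c ≠ 0) (hc : ¬ π ∣ c) (b : D) :
    residueSum (π * u) (π * w) F (Ideal.span {π ^ 2 * c}) (π ^ 2 * b) =
      idealIndex (Ideal.span {π}) * F (Ideal.span {π ^ 2}) +
        (idealIndex (Ideal.span {π}) ^ 2 - idealIndex (Ideal.span {π}) : ℕ) *
          F (Ideal.span {π}) := by
  classical
  have hco := isCoprime_of_prime_of_not_dvd hπ hc
  obtain ⟨h₀, hh₀⟩ := exists_congruence_iff (isCoprime_of_isUnit_left hv c) b
  rw [sq π, mul_assoc π π b,
    residueSum_of_dvd hu hw hπ huvw F hc0 (d := π * π) (mul_ne_zero hπ.ne_zero hπ.ne_zero)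
      (Dvd.intro _ rfl) (mul_assoc _ _ _).symm (e := v) (by ring) hh₀]
  have hsq : idealIndex (Ideal.span {π * π}) = idealIndex (Ideal.span {π}) ^ 2 := by
    rw [idealIndex_span_mul hπ.ne_zero, sq]
  have h1 := tsum_quotient_ite (d := π) hπ.ne_zero (e := -u * c)
    ((isCoprime_of_isUnit_left hu.neg π).mul_left hco.symm) (π * b - u * h₀) hN (by rw [hsq]; exact pow_ne_zero _ hN)
    (F (Ideal.span {π})) (F (Ideal.span {π * π}))
  rw [hsq] at h1
  simp only [sq π]
  exact h1

/-- Valuation at least `3`: all solutions agree with `h₀` modulo `π`, and `c ∣ b + v h₀` makes `π ∣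
h₀` equivalent to `π ∣ b`. Hence all of them give the same ideal. -/
theorem residueSum_of_cube_dvd (hu : IsUnit u) (hv : IsUnit v) (hw : IsUnit w)
    (hπ : Prime π) (huvw : π * w - π * u = π ^ 2 * v) (F : Ideal D → ℝ≥0∞)
    (hN : idealIndex (Ideal.span {π}) ≠ 0) {c : D}
    (hc0 : c ≠ 0) (hc : π ∣ c) (b : D) [Decidable (π ∣ b)] :
    residueSum (π * u) (π * w) F (Ideal.span {π ^ 2 * c}) (π ^ 2 * b) =
      (idealIndex (Ideal.span {π}) ^ 2 : ℕ)*
        if π ∣ b then F (Ideal.span {π ^ 2}) else F (Ideal.span {π}) := by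
  classical
  obtain ⟨h₀, hh₀⟩ := exists_congruence_iff (isCoprime_of_isUnit_left hv c) b
  rw [sq π, mul_assoc π π b,
    residueSum_of_dvd hu hw hπ huvw F hc0 (d := π * π) (mul_ne_zero hπ.ne_zero hπ.ne_zero)
      (Dvd.intro _ rfl) (mul_assoc _ _ _).symm (e := v) (by ring) hh₀]
  have hsq : idealIndex (Ideal.span {π * π}) = idealIndex (Ideal.span {π}) ^ 2 := by
    rw [idealIndex_span_mul hπ.ne_zero, sq]
  have hcond (k : D) : π ∣ π * b - u * h₀ + -u * c * k ↔ π ∣ b := by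
    have h1 : c ∣ b + v * h₀ := (hh₀ h₀).mpr (by simp)
    rw [dvd_add_left ((hc.mul_left _).mul_right _), dvd_sub_right (Dvd.intro _ rfl),
      hu.dvd_mul_left, ← hv.dvd_mul_left]
    exact ⟨fun h => (dvd_add_left h).mp (hc.trans h1), fun h => (dvd_add_right h).mp (hc.trans h1)⟩
  have : Finite (D ⧸ Ideal.span {π * π}) :=
    finite_quotient_of_idealIndex_ne_zero (by rw [hsq]; exact pow_ne_zero _ hN)
  simp only [hcond]
  rw [ENNReal.tsum_const, ENat.card_eq_coe_natCard, ← idealIndex_eq_card, hsq, ← sq π]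
  split_ifs <;> simp

end LocalCount

/-! ### Assembling the numerator polynomial -/

section CubicSum

variable {D : Type*} [CommRing D] [IsDomain D] [IsPrincipalIdealRing D]

/-- The weight of the index of `a`, restricted to the ideals `a` contained in `(π ^ k)`. -/
def weightDvd (W : ℕ →*₀ ℝ≥0∞) (π : D) (k : ℕ) (a : Ideal D) : ℝ≥0∞ :=
  open Classical in if π ^ k ∣ gen a then W (idealIndex a) else 0

/-- The weight of the index of `a`, restricted to the ideals `a` contained in `(π ^ k)` but not in
`(π ^ (k + 1))`. -/
def weightExact (W : ℕ →*₀ ℝ≥0∞) (π : D) (k : ℕ) (a : Ideal D) : ℝ≥0∞ :=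
  open Classical in if π ^ k ∣ gen a ∧ ¬ π ^ (k + 1) ∣ gen a then W (idealIndex a) else 0

omit [IsPrincipalIdealRing D] in
theorem idealIndex_span_pow {π : D} (hπ : π ≠ 0) (k : ℕ) :
    idealIndex (Ideal.span {π ^ k}) = idealIndex (Ideal.span {π}) ^ k := by
  induction k with
  | zero => rw [pow_zero, pow_zero, Ideal.span_singleton_one, idealIndex_top]
  | succ k ih => rw [pow_succ', idealIndex_span_mul hπ, ih, pow_succ']

theorem tsum_weightDvd (W : ℕ →*₀ ℝ≥0∞) {π : D} (hπ : π ≠ 0) (k : ℕ) :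
    ∑' a, weightDvd W π k a = W (idealIndex (Ideal.span {π})) ^ k * idealSum D W := by
  classical
  rw [← map_pow, ← idealIndex_span_pow hπ, ← tsum_ideal_le W (pow_ne_zero k hπ)]
  refine tsum_congr fun a => ?_
  unfold weightDvd
  congr 1
  rw [← Ideal.span_singleton_le_span_singleton, span_gen]

/-- Stated additively because subtraction in `ℝ≥0∞` is truncated. -/
theorem tsum_weightExact (W : ℕ →*₀ ℝ≥0∞) {π : D} (hπ : π ≠ 0) (k : ℕ) :
    ∑' a, weightExact W π k a + W (idealIndex (Ideal.span {π})) ^ (k + 1) * idealSum D W =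
      W (idealIndex (Ideal.span {π})) ^ k * idealSum D W := by
  rw [← tsum_weightDvd W hπ, ← tsum_weightDvd W hπ, ← ENNReal.tsum_add]
  refine tsum_congr fun a => ?_
  unfold weightDvd weightExact
  have := (pow_dvd_pow π k.le_succ).trans (c := gen a)
  split_ifs <;> simp_all

variable {π u v w : D}

/-- The table of the four cases for `c`, written as products of a function of `c` and a function of
`b`, so that the double sum splits. -/
theorem weight_mul_residueSum (hbot : idealIndex (⊥ : Ideal D) = 0) (W : ℕ →*₀ ℝ≥0∞)
    (hu : IsUnit u) (hv : IsUnit v) (hw : IsUnit w)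
    (hπ : Prime π) (huvw : π * w - π * u = π ^ 2 * v)
    (hN : idealIndex (Ideal.span {π}) ≠ 0) (F : Ideal D → ℝ≥0∞) {q : ℕ}
    (hq : idealIndex (Ideal.span {π}) = q) {f₀ f₁ f₂ : ℝ≥0∞}
    (h₀ : F ⊤ = f₀) (h₁ : F (Ideal.span {π}) = f₁) (h₂ : F (Ideal.span {π ^ 2}) = f₂)
    (c b : Ideal D) :
    W (idealIndex b) * W (idealIndex c) * residueSum (π * u) (π * w) F c (gen b) =
      weightExact W π 0 c * (weightExact W π 0 b * f₀ + weightDvd W π 1 b * f₁) +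
      weightExact W π 1 c * (weightDvd W π 1 b * (f₂ + (q - 1 : ℕ) * f₁)) +
      weightExact W π 2 c * (weightDvd W π 2 b * (q * f₂ + (q ^ 2 - q : ℕ) * f₁)) +
      weightDvd W π 3 c * (weightExact W π 2 b * ((q ^ 2 : ℕ) * f₁) +
        weightDvd W π 3 b * ((q ^ 2 : ℕ) * f₂)) := by
  classical
  subst hq h₀ h₁ h₂
  by_cases hb : b = ⊥
  · simp [hb, weightDvd, weightExact, hbot]
  by_cases hc : c = ⊥
  · simp [hc, weightDvd, weightExact, hbot]
  obtain ⟨x, hx⟩ : ∃ x, gen c = x := ⟨_, rfl⟩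
  obtain ⟨y, hy⟩ : ∃ y, gen b = y := ⟨_, rfl⟩
  have hcx : c = Ideal.span {x} := by rw [← hx, span_gen]
  have hx0 : x ≠ 0 := by rw [← hx]; exact mt gen_eq_zero.mp hc
  unfold weightDvd weightExact
  simp only [hx, hy, pow_zero, one_dvd, true_and, zero_add, pow_one, Nat.reduceAdd]
  rw [show residueSum (π * u) (π * w) F c y = residueSum (π * u) (π * w) F (Ideal.span {x}) y by
    rw [hcx]]
  have hle {z : D} {i j : ℕ} (hij : i ≤ j) (h : ¬ π ^ i ∣ z) : ¬ π ^ j ∣ z :=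
    fun h' => h ((pow_dvd_pow π hij).trans h')
  have hle' {z : D} {i j : ℕ} (hij : i ≤ j) (h : π ^ j ∣ z) : π ^ i ∣ z :=
    (pow_dvd_pow π hij).trans h
  by_cases h1 : π ∣ x
  swap
  · have h1' : ¬ π ^ 1 ∣ x := by rwa [pow_one]
    have h2 := hle one_le_two h1'
    have h3 := hle (show 1 ≤ 3 by norm_num) h1'
    rw [residueSum_of_not_dvd hu hv hw hπ huvw F hx0 h1]
    simp only [h1, h2, h3, not_false_eq_true, if_true, if_false, false_and, zero_mul, add_zero]
    split_ifs <;> simp_all <;> ring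
  by_cases h2 : π ^ 2 ∣ x
  swap
  · have h3 := hle (show 2 ≤ 3 by norm_num) h2
    simp only [h1, h2, h3, not_true_eq_false, not_false_eq_true, if_true, if_false, false_and,
      true_and, zero_mul, add_zero, zero_add]
    by_cases hy1 : π ∣ y
    · obtain ⟨x, rfl⟩ := h1
      obtain ⟨y, rfl⟩ := hy1
      rw [sq, mul_dvd_mul_iff_left hπ.ne_zero] at h2
      rw [residueSum_of_dvd_of_not_sq_dvd hu hv hw hπ huvw F hN (right_ne_zero_of_mul hx0) h2,
        if_pos (Dvd.intro _ rfl)]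
      ring
    · rw [residueSum_eq_zero huvw F (dvd_pow_self π two_ne_zero) h1 hy1, if_neg hy1]
      simp
  by_cases hy2 : π ^ 2 ∣ y
  swap
  · have hy3 := hle (show 2 ≤ 3 by norm_num) hy2
    rw [residueSum_eq_zero huvw F dvd_rfl h2 hy2]
    simp [h1, h2, hy2, hy3]
  have hdvd3 (z : D) : π ^ 3 ∣ π ^ 2 * z ↔ π ∣ z := by
    rw [pow_succ π 2, mul_dvd_mul_iff_left (pow_ne_zero 2 hπ.ne_zero)]
  obtain ⟨x, rfl⟩ := h2
  obtain ⟨y, rfl⟩ := hy2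
  have hππ : π ∣ π ^ 2 * x := h1
  simp only [hdvd3, hππ, dvd_mul_right, not_true_eq_false, if_false, and_false, true_and,
    zero_mul, zero_add]
  by_cases h3 : π ∣ x
  · rw [residueSum_of_cube_dvd hu hv hw hπ huvw F hN (right_ne_zero_of_mul hx0) h3]
    by_cases hy : π ∣ y <;>
      simp only [h3, hy, not_true_eq_false, not_false_eq_true, if_true, if_false, zero_mul,
        zero_add, add_zero] <;> ring
  · rw [residueSum_of_sq_dvd hu hv hw hπ huvw F hN (right_ne_zero_of_mul hx0) h3]
    simp only [h3, not_false_eq_true, if_true, if_false]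
    ring

open Classical in
theorem tsum_ideal_cubic (hbot : idealIndex (⊥ : Ideal D) = 0) (W : ℕ →*₀ ℝ≥0∞)
    (hu : IsUnit u) (hv : IsUnit v) (hw : IsUnit w)
    (hπ : Prime π) (huvw : π * w - π * u = π ^ 2 * v) {q : ℕ}
    (hq : idealIndex (Ideal.span {π}) = q) (hq0 : q ≠ 0) :
    ∑' I : Ideal D[X], W (idealIndex I) *
        (if X * ((X - C (π * u)) * (X - C (π * w))) ∈ I then 1 else 0) =
      idealSum D W * (
        (∑' a : Ideal D, weightExact W π 0 a) * ((∑' a : Ideal D, weightExact W π 0 a) * 1 +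
          (W q ^ 1 * idealSum D W) * (q * W q)) +
        (∑' a : Ideal D, weightExact W π 1 a) *
          ((W q ^ 1 * idealSum D W) * ((q * W q) ^ 2 + (q - 1 : ℕ) * (q * W q))) +
        (∑' a : Ideal D, weightExact W π 2 a) *
          ((W q ^ 2 * idealSum D W) * (q * (q * W q) ^ 2 + (q ^ 2 - q : ℕ) * (q * W q))) +
        (W q ^ 3 * idealSum D W) *
          ((∑' a : Ideal D, weightExact W π 2 a) * ((q ^ 2 : ℕ) * (q * W q)) +
            (W q ^ 3 * idealSum D W) * ((q ^ 2 : ℕ) * (q * W q) ^ 2))) := by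
  have h1 := tsum_ideal_linear_factor hbot W 0 ((X - C (π * u)) * (X - C (π * w)))
  rw [C_0, sub_zero] at h1
  rw [h1, tsum_ideal_quadratic hbot W (π * u) (π * w) 0 (normWeight W)]
  congr 1
  have h₀ : normWeight W (⊤ : Ideal D) = 1 := by simp [normWeight, idealIndex_top]
  have h₁ : normWeight W (Ideal.span {π}) = q * W q := by rw [normWeight, hq]
  have h₂ : normWeight W (Ideal.span {π ^ 2}) = (q * W q) ^ 2 := by
    rw [normWeight, idealIndex_span_pow hπ.ne_zero, hq, map_pow, Nat.cast_pow, mul_pow]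
  have h2 (c b : Ideal D) := weight_mul_residueSum hbot W hu hv hw hπ huvw (by rwa [hq])
    (normWeight W) hq h₀ h₁ h₂ c b
  unfold residueSum at h2
  simp only [h2]
  simp only [ENNReal.tsum_add, ENNReal.tsum_mul_left, ENNReal.tsum_mul_right,
    tsum_weightDvd W hπ.ne_zero, hq]

/-- The numerator polynomial of the zeta function of `D[X] / (X (X - α) (X - β))`. -/
def cubicNumerator {K : Type*} [CommRing K] (p x : K) : K :=
  p ^ 4 * x ^ 8 - 2 * p ^ 3 * x ^ 7 + (p ^ 3 + p ^ 2) * x ^ 6 + (p ^ 3 - 2 * p ^ 2) * x ^ 5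
    + p * x ^ 4 + (p ^ 2 - 2 * p) * x ^ 3 + (p + 1) * x ^ 2 - 2 * x + 1

open Classical in
theorem tsum_ideal_cubic_toReal (hbot : idealIndex (⊥ : Ideal D) = 0) (W : ℕ →*₀ ℝ≥0∞)
    (hW : idealSum D W ≠ ⊤)
    (hu : IsUnit u) (hv : IsUnit v) (hw : IsUnit w)
    (hπ : Prime π) (huvw : π * w - π * u = π ^ 2 * v) {q : ℕ}
    (hq : idealIndex (Ideal.span {π}) = q) (hq0 : q ≠ 0) :
    ∑' I : Ideal D[X], W (idealIndex I) *
        (if X * ((X - C (π * u)) * (X - C (π * w))) ∈ I then 1 else 0) ≠ ⊤ ∧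
    (∑' I : Ideal D[X], W (idealIndex I) *
        (if X * ((X - C (π * u)) * (X - C (π * w))) ∈ I then 1 else 0)).toReal =
      cubicNumerator (q : ℝ) (W q).toReal * (idealSum D W).toReal ^ 3 := by
  have hx : W q ≠ ⊤ := by
    rw [← hq]
    exact ne_top_of_le_ne_top hW (ENNReal.le_tsum (f := fun a => W (idealIndex a)) _)
  have hE (k : ℕ) := tsum_weightExact W hπ.ne_zero k
  rw [tsum_ideal_cubic hbot W hu hv hw hπ huvw hq hq0]
  obtain ⟨r, hr⟩ : ∃ r, r = q - 1 := ⟨_, rfl⟩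
  obtain ⟨t, ht⟩ : ∃ t, t = q ^ 2 - q := ⟨_, rfl⟩
  rw [← hr, ← ht]
  -- The natural subtractions are not truncated, because `q ≠ 0`.
  have hr' : (r : ℝ) = q - 1 := by
    rw [hr, Nat.cast_sub (Nat.one_le_iff_ne_zero.mpr hq0), Nat.cast_one]
  have ht' : (t : ℝ) = q ^ 2 - q := by
    rw [ht, Nat.cast_sub (Nat.le_self_pow two_ne_zero q), Nat.cast_pow]
  rw [hq] at hE
  have hE0 := hE 0
  have hE1 := hE 1
  have hE2 := hE 2
  obtain ⟨z, hz⟩ : ∃ r : NNReal, (r : ℝ≥0∞) = _ := ⟨_, ENNReal.coe_toNNReal hW⟩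
  obtain ⟨x, hx⟩ : ∃ r : NNReal, (r : ℝ≥0∞) = _ := ⟨_, ENNReal.coe_toNNReal hx⟩
  have hfin (k : ℕ) : ∑' a, weightExact W π k a ≠ ⊤ := by
    refine ne_top_of_le_ne_top ?_ (le_self_add.trans (hE k).le)
    rw [← hz, ← hx]
    finiteness
  obtain ⟨e₀, he₀⟩ : ∃ r : NNReal, (r : ℝ≥0∞) = _ := ⟨_, ENNReal.coe_toNNReal (hfin 0)⟩
  obtain ⟨e₁, he₁⟩ : ∃ r : NNReal, (r : ℝ≥0∞) = _ := ⟨_, ENNReal.coe_toNNReal (hfin 1)⟩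
  obtain ⟨e₂, he₂⟩ : ∃ r : NNReal, (r : ℝ≥0∞) = _ := ⟨_, ENNReal.coe_toNNReal (hfin 2)⟩
  rw [← hx, ← hz, ← he₀] at hE0
  rw [← hx, ← hz, ← he₁] at hE1
  rw [← hx, ← hz, ← he₂] at hE2
  rw [← hx, ← hz, ← he₀, ← he₁, ← he₂]
  norm_cast at hE0 hE1 hE2 ⊢
  refine ⟨ENNReal.coe_ne_top, ?_⟩
  simp only [ENNReal.coe_toReal]
  have hE0' := congrArg NNReal.toReal hE0
  have hE1' := congrArg NNReal.toReal hE1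
  have hE2' := congrArg NNReal.toReal hE2
  push_cast at hE0' hE1' hE2' ⊢
  have h0 : (e₀ : ℝ) = z - x * z := by linear_combination hE0'
  have h1 : (e₁ : ℝ) = x * z - x ^ 2 * z := by linear_combination hE1'
  have h2 : (e₂ : ℝ) = x ^ 2 * z - x ^ 3 * z := by linear_combination hE2'
  rw [h0, h1, h2, hr', ht', cubicNumerator]
  ring

end CubicSum

/-! ### Dirichlet series of ideal zeta functions -/

section Dirichlet

/-- `f` has the Dirichlet series value `v` at `s`. -/
def HasValue (f : ArithmeticFunction ℤ) (s v : ℂ) : Prop :=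
  LSeriesHasSum (fun n => (f n : ℂ)) s v

variable {f g : ArithmeticFunction ℤ} {s v w : ℂ}

theorem HasValue.congr (hf : HasValue f s v) (h : v = w) : HasValue f s w := h ▸ hf

theorem HasValue.unique (hf : HasValue f s v) (hg : HasValue f s w) : v = w :=
  HasSum.unique hf hg

theorem HasValue.add (hf : HasValue f s v) (hg : HasValue g s w) : HasValue (f + g) s (v + w) := by
  have := LSeriesHasSum.add hf hg
  unfold HasValue
  convert this using 1
  ext n
  simp

theorem HasValue.sub (hf : HasValue f s v) (hg : HasValue g s w) : HasValue (f - g) s (v - w) := by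
  have := LSeriesHasSum.sub hf hg
  unfold HasValue
  convert this using 1
  ext n
  simp [sub_eq_add_neg]

theorem HasValue.mul (hf : HasValue f s v) (hg : HasValue g s w) : HasValue (f * g) s (v * w) := by
  have := ArithmeticFunction.LSeriesHasSum_mul (f := (f : ArithmeticFunction ℂ))
    (g := (g : ArithmeticFunction ℂ)) (s := s) (a := v) (b := w)
    (by simpa [HasValue] using hf) (by simpa [HasValue] using hg)
  rw [← ArithmeticFunction.intCoe_mul] at this
  simpa [HasValue] using this

theorem hasValue_dirichletMonomial {m : ℕ} (hm : m ≠ 0) (s : ℂ) :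
    HasValue (dirichletMonomial m) s ((m : ℂ) ^ (-s)) := by
  unfold HasValue LSeriesHasSum
  convert hasSum_single m ?_ using 1
  · rw [LSeries.term_of_ne_zero hm, Complex.cpow_neg, dirichletMonomial]
    simp [hm]
  · intro n hn
    simp [LSeries.term, dirichletMonomial, hn]

theorem dirichletMonomial_one : dirichletMonomial 1 = 1 := by
  ext n
  rw [ArithmeticFunction.one_apply]
  simp only [dirichletMonomial, ArithmeticFunction.coe_mk]
  congr 1
  simp only [eq_iff_iff, and_iff_right_iff_imp]
  rintro rfl
  exact one_ne_zero

theorem hasValue_one (s : ℂ) : HasValue 1 s 1 := by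
  rw [← dirichletMonomial_one]
  exact (hasValue_dirichletMonomial one_ne_zero s).congr (by simp)

theorem HasValue.pow (hf : HasValue f s v) (k : ℕ) : HasValue (f ^ k) s (v ^ k) := by
  induction k with
  | zero => simpa using hasValue_one s
  | succ k ih => simpa only [pow_succ] using ih.mul hf

theorem hasValue_natCast (s : ℂ) (k : ℕ) : HasValue (k : ArithmeticFunction ℤ) s k := by
  induction k with
  | zero =>
    have := (hasValue_one s).sub (hasValue_one s)
    rw [sub_self, sub_self] at this
    simpa using this
  | succ k ih => simpa only [Nat.cast_succ] using ih.add (hasValue_one s)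

theorem hasValue_two (s : ℂ) : HasValue 2 s 2 := hasValue_natCast s 2

theorem HasValue.cubicNumerator (hf : HasValue f s v) (hg : HasValue g s w) :
    HasValue (cubicNumerator f g) s (cubicNumerator v w) := by
  have h2 := hasValue_two s
  have h1 := hasValue_one s
  exact (((((((((hf.pow 4).mul (hg.pow 8)).sub ((h2.mul (hf.pow 3)).mul (hg.pow 7))).add
    (((hf.pow 3).add (hf.pow 2)).mul (hg.pow 6))).add
    (((hf.pow 3).sub (h2.mul (hf.pow 2))).mul (hg.pow 5))).add (hf.mul (hg.pow 4))).add
    (((hf.pow 2).sub (h2.mul hf)).mul (hg.pow 3))).add ((hf.add h1).mul (hg.pow 2))).sub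
    (h2.mul hg)).add h1

/-- Dirichlet coefficients are determined by the values on a real half-line; this turns the analytic
identity into the formal one. -/
theorem eq_of_hasValue {σ : ℝ} (F : ℝ → ℂ) (hf : ∀ s : ℝ, σ < s → HasValue f s (F s))
    (hg : ∀ s : ℝ, σ < s → HasValue g s (F s)) : f = g := by
  have habs {h : ArithmeticFunction ℤ} (hh : ∀ s : ℝ, σ < s → HasValue h s (F s)) :
      LSeries.abscissaOfAbsConv (fun n => (h n : ℂ)) < ⊤ :=
    (LSeriesHasSum.LSeriesSummable (hh (σ + 1) (by linarith))).abscissaOfAbsConv_le.trans_lt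
      (EReal.coe_lt_top _)
  have key := fun {n : ℕ} (hn : n ≠ 0) =>
    LSeries.eq_of_LSeries_eventually_eq (habs hf) (habs hg) (by
      filter_upwards [Filter.eventually_gt_atTop σ] with s hs
      rw [(hf s hs).LSeries_eq, (hg s hs).LSeries_eq]) hn
  ext n
  rcases eq_or_ne n 0 with rfl | hn
  · simp
  · exact_mod_cast key hn

end Dirichlet

/-! ### From weighted sums to zeta functions -/

section IdealZeta

/-- The weight `n ↦ n ^ (-s)`. -/
def powWeight (s : ℝ) (hs : 0 < s) : ℕ →*₀ ℝ≥0∞ where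
  toFun n := ((n : NNReal) ^ (-s) : NNReal)
  map_zero' := by simp [NNReal.zero_rpow (neg_ne_zero.mpr hs.ne')]
  map_one' := by simp
  map_mul' m n := by push_cast [NNReal.mul_rpow]; rfl

theorem powWeight_apply (s : ℝ) (hs : 0 < s) (n : ℕ) :
    powWeight s hs n = ((n : NNReal) ^ (-s) : NNReal) := rfl

theorem powWeight_ne_zero {s : ℝ} (hs : 0 < s) {n : ℕ} (hn : n ≠ 0) : powWeight s hs n ≠ 0 := by
  rw [powWeight_apply]
  simp [NNReal.rpow_eq_zero_iff, hn]

theorem toReal_powWeight {s : ℝ} (hs : 0 < s) (n : ℕ) :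
    ((powWeight s hs n).toReal : ℂ) = (n : ℂ) ^ (-(s : ℂ)) := by
  rw [powWeight_apply, ENNReal.coe_toReal, NNReal.coe_rpow, NNReal.coe_natCast,
    Complex.ofReal_cpow (Nat.cast_nonneg n)]
  simp

variable {R : Type*} [CommRing R]

theorem isFullIdeal_of_idealIndex_ne_zero {I : Ideal R} (h : idealIndex I ≠ 0) : IsFullIdeal I :=
  fun r => ⟨idealIndex I, h, I.toAddSubgroup.nsmul_index_mem r⟩

theorem fullIdealsOfIndex_eq {n : ℕ} (hn : n ≠ 0) :
    fullIdealsOfIndex R n = {I | idealIndex I = n} := by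
  ext I
  exact ⟨fun h => h.2, fun h => ⟨isFullIdeal_of_idealIndex_ne_zero (h.symm ▸ hn), h⟩⟩

theorem idealSum_eq_tsum_card (W : ℕ →*₀ ℝ≥0∞) :
    idealSum R W = ∑' n : ℕ, (ENat.card {I : Ideal R | idealIndex I = n} : ℝ≥0∞) * W n := by
  rw [idealSum, ← ENNReal.tsum_fiberwise _ (fun I : Ideal R => idealIndex I)]
  refine tsum_congr fun n => ?_
  rw [← ENNReal.tsum_const]
  exact tsum_congr fun I => congrArg W I.2

/-- Infinitely many ideals of index `n` would contribute `⊤` to a finite sum. -/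
theorem finite_fullIdealsOfIndex {s : ℝ} (hs : 0 < s) (h : idealSum R (powWeight s hs) ≠ ⊤) {n : ℕ}
    (hn : n ≠ 0) : (fullIdealsOfIndex R n).Finite := by
  rw [fullIdealsOfIndex_eq hn, Set.Finite, ← ENat.card_lt_top]
  rw [idealSum_eq_tsum_card] at h
  have h1 := ENNReal.ne_top_of_tsum_ne_top h n
  by_contra h2
  rw [not_lt_top_iff] at h2
  rw [h2] at h1
  exact h1 (ENNReal.top_mul (powWeight_ne_zero hs hn))

theorem hasValue_idealZeta {s : ℝ} (hs : 0 < s) (h : idealSum R (powWeight s hs) ≠ ⊤) :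
    HasValue (idealZeta R) s (idealSum R (powWeight s hs)).toReal := by
  have h1 := h
  rw [idealSum_eq_tsum_card] at h1
  unfold HasValue LSeriesHasSum
  have h2 := ENNReal.hasSum_toReal h1
  rw [← ENNReal.tsum_toReal_eq (ENNReal.ne_top_of_tsum_ne_top h1), ← idealSum_eq_tsum_card] at h2
  convert Complex.hasSum_ofReal.mpr h2 using 1
  ext n
  rcases eq_or_ne n 0 with rfl | hn
  · simp
  have hfin := finite_fullIdealsOfIndex hs h hn
  rw [LSeries.term_of_ne_zero hn, ENNReal.toReal_mul, Complex.ofReal_mul, toReal_powWeight,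
    Complex.cpow_neg, div_eq_mul_inv]
  congr 1
  have : idealZeta R n = ((fullIdealsOfIndex R n).ncard : ℤ) := if_neg hn
  rw [this]
  rw [fullIdealsOfIndex_eq hn] at hfin ⊢
  rw [ENat.card_coe_set_eq, ← hfin.cast_ncard_eq]
  simp

theorem idealZetaWellDefined_of_idealSum_ne_top {s : ℝ} (hs : 0 < s)
    (h : idealSum R (powWeight s hs) ≠ ⊤)
    (hfull : ∀ I : Ideal R, IsFullIdeal I → idealIndex I ≠ 0) : IdealZetaWellDefined R :=
  ⟨hfull, fun _ hn => finite_fullIdealsOfIndex hs h hn⟩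

theorem lseriesSummable_idealZeta {s : ℂ} (hs : 0 < s.re)
    (h : idealSum R (powWeight s.re hs) ≠ ⊤) :
    LSeriesSummable (fun n => (idealZeta R n : ℂ)) s :=
  (LSeriesSummable_iff_of_re_eq_re (by simp)).mp
    (LSeriesHasSum.LSeriesSummable (hasValue_idealZeta hs h))

end IdealZeta

/-! ### Quotients of `D[X]` by three linear factors -/

section CubicQuotient

variable {D R : Type*} [CommRing D] [CommRing R]

theorem idealIndex_ne_zero_of_linear_mul_mem {γ n : D} {g : D[X]}
    (hfin : ∀ a : Ideal D, n ∈ a → idealIndex a ≠ 0)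
    (hg : ∀ J : Ideal D[X], g ∈ J → C n ∈ J → idealIndex J ≠ 0)
    {I : Ideal D[X]} (hI : (X - C γ) * g ∈ I) (hn : C n ∈ I) : idealIndex I ≠ 0 := by
  rw [idealIndex_eq_map_mul_colonBy (evalRingHom_surjective γ) (ker_evalRingHom γ)]
  refine mul_ne_zero (hfin _ ?_) (hg _ hI (I.mul_mem_left _ hn))
  have := Ideal.mem_map_of_mem (evalRingHom γ) hn
  simpa using this

/-- Full ideals of a quotient of `D[X]` by a product of three linear factors have finite index. -/
theorem idealIndex_ne_zero_of_isFullIdeal [CharZero D]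
    (hfin : ∀ a : Ideal D, a ≠ ⊥ → idealIndex a ≠ 0) {φ : D[X] →+* R}
    (hφ : Function.Surjective φ) {α β : D}
    (hker : RingHom.ker φ = Ideal.span {X * ((X - C α) * (X - C β))}) {I : Ideal R}
    (hI : IsFullIdeal I) : idealIndex I ≠ 0 := by
  obtain ⟨n, hn, h⟩ := hI 1
  have hfin' (a : Ideal D) (ha : (n : D) ∈ a) : idealIndex a ≠ 0 := by
    refine hfin a ?_
    rintro rfl
    exact hn (by simpa using ha)
  rw [← idealIndex_comap hφ]
  refine idealIndex_ne_zero_of_linear_mul_mem (γ := 0) (g := (X - C α) * (X - C β)) hfin'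
    (fun J => idealIndex_ne_zero_of_linear_mul_mem hfin' (fun K hK =>
      idealIndex_ne_zero_of_linear_mul_mem (g := 1) hfin' (fun L hL _ => ?_) (by rwa [mul_one]))) ?_ ?_
  · rw [L.eq_top_of_isUnit_mem hL isUnit_one, idealIndex_top]
    exact one_ne_zero
  · rw [C_0, sub_zero, Ideal.mem_comap]
    have : X * ((X - C α) * (X - C β)) ∈ RingHom.ker φ := hker ▸ Ideal.mem_span_singleton_self _
    rw [RingHom.mem_ker] at this
    rw [this]
    exact I.zero_mem
  · simpa using h

open Classical in
theorem idealSum_eq_tsum_comap {A : Type*} [CommRing A] {φ : A →+* R}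
    (hφ : Function.Surjective φ) {f : A} (hker : RingHom.ker φ = Ideal.span {f})
    (W : ℕ →*₀ ℝ≥0∞) :
    idealSum R W = ∑' I : Ideal A, W (idealIndex I) * (if f ∈ I then 1 else 0) := by
  have hinj : Function.Injective (fun c : Ideal R => c.comap φ) :=
    Ideal.comap_injective_of_surjective _ hφ
  rw [idealSum, ← hinj.tsum_eq]
  · refine tsum_congr fun c => ?_
    rw [idealIndex_comap hφ, if_pos, mul_one]
    have : f ∈ RingHom.ker φ := hker ▸ Ideal.mem_span_singleton_self _
    rw [RingHom.mem_ker] at this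
    rw [Ideal.mem_comap, this]
    exact c.zero_mem
  · intro K hK
    have hmem : f ∈ K := by
      by_contra h
      exact hK (by simp [h])
    refine ⟨K.map φ, ?_⟩
    simp only
    rw [Ideal.comap_map_of_surjective' _ hφ, hker, sup_eq_left, Ideal.span_singleton_le_iff_mem]
    exact hmem

variable [IsDomain D] [IsPrincipalIdealRing D] [CharZero D]

/-- The zeta function of `D[X] / (X (X - α) (X - β))`, where `α`, `β` and `β - α` are associated to
`π`, `π` and `π ^ 2` for a prime `π`. -/
theorem idealZeta_cubic (hbot : idealIndex (⊥ : Ideal D) = 0)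
    (hfin : ∀ a : Ideal D, a ≠ ⊥ → idealIndex a ≠ 0) {σ : ℝ} (hσ : 0 ≤ σ)
    (hsum : ∀ (s : ℝ) (hs : 0 < s), σ < s → idealSum D (powWeight s hs) ≠ ⊤)
    {π u v w : D} (hu : IsUnit u) (hv : IsUnit v) (hw : IsUnit w)
    (hπ : Prime π) (huvw : π * w - π * u = π ^ 2 * v) {q : ℕ}
    (hq : idealIndex (Ideal.span {π}) = q) {φ : D[X] →+* R}
    (hφ : Function.Surjective φ)
    (hker : RingHom.ker φ = Ideal.span {X * ((X - C (π * u)) * (X - C (π * w)))}) :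
    IdealZetaWellDefined R ∧
      idealZeta R = cubicNumerator (q : ArithmeticFunction ℤ) (dirichletMonomial q) *
        idealZeta D ^ 3 ∧
      ∀ s : ℂ, σ < s.re → LSeriesSummable (fun n => (idealZeta R n : ℂ)) s := by
  classical
  have hq0 : q ≠ 0 := by
    rw [← hq]
    exact hfin _ (by simpa using hπ.ne_zero)
  have key (s : ℝ) (hs : 0 < s) (h : σ < s) := tsum_ideal_cubic_toReal hbot (powWeight s hs)
    (hsum s hs h) hu hv hw hπ huvw hq hq0
  simp only [← idealSum_eq_tsum_comap hφ hker] at key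
  refine ⟨idealZetaWellDefined_of_idealSum_ne_top (s := σ + 1) (by linarith)
    (key _ _ (by linarith)).1 fun I => idealIndex_ne_zero_of_isFullIdeal hfin hφ hker, ?_,
    fun s hs => lseriesSummable_idealZeta (hσ.trans_lt hs) (key _ _ hs).1⟩
  -- The default `0` is never reached, because `σ ≥ 0`.
  refine eq_of_hasValue (σ := σ) (fun s => if hs : 0 < s then
    ((idealSum R (powWeight s hs)).toReal : ℂ) else 0) (fun s hs => ?_) (fun s hs => ?_)
  · have hs0 := hσ.trans_lt hs
    rw [dif_pos hs0]
    exact hasValue_idealZeta hs0 (key s hs0 hs).1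
  · have hs0 := hσ.trans_lt hs
    rw [dif_pos hs0, (key s hs0 hs).2]
    refine (((hasValue_natCast s q).cubicNumerator (hasValue_dirichletMonomial hq0 s)).mul
      ((hasValue_idealZeta hs0 (hsum s hs0 hs)).pow 3)).congr ?_
    rw [← toReal_powWeight hs0]
    simp [cubicNumerator]

end CubicQuotient

/-! ### The base ring `ℤ_(p)` -/

section Localized

variable (p : ℕ) [hp : Fact p.Prime]

theorem span_natCast_ne_bot : Ideal.span {(p : ℤ)} ≠ ⊥ := by
  simpa using hp.out.ne_zero

instance isDiscreteValuationRing_zLoc : IsDiscreteValuationRing (ZLoc p) :=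
  IsLocalization.AtPrime.isDiscreteValuationRing_of_dedekind_domain ℤ (span_natCast_ne_bot p) _

instance charZero_zLoc : CharZero (ZLoc p) :=
  charZero_of_injective_algebraMap (R := ℤ)
    (IsLocalization.injective (ZLoc p)
      (Ideal.primeCompl_le_nonZeroDivisors (Ideal.span {(p : ℤ)})))

theorem maximalIdeal_zLoc : IsLocalRing.maximalIdeal (ZLoc p) = Ideal.span {(p : ZLoc p)} := by
  have := Localization.AtPrime.map_eq_maximalIdeal (I := Ideal.span {(p : ℤ)})
  rw [← this, Ideal.map_span, Set.image_singleton, map_natCast]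

theorem prime_zLoc : Prime (p : ZLoc p) := by
  rw [← Ideal.span_singleton_prime (Nat.cast_ne_zero.mpr hp.out.ne_zero), ← maximalIdeal_zLoc]
  exact (IsLocalRing.maximalIdeal.isMaximal _).isPrime

theorem idealIndex_span_int (n : ℕ) : idealIndex (Ideal.span {(n : ℤ)}) = n := by
  rw [idealIndex_eq_card, Nat.card_congr (Int.quotientSpanNatEquivZMod n).toEquiv, Nat.card_zmod]

theorem idealIndex_span_zLoc : idealIndex (Ideal.span {(p : ZLoc p)}) = p := by
  have hmax : (Ideal.span {(p : ℤ)}).IsMaximal :=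
    (isPrime_span_natPrime p).isMaximal (span_natCast_ne_bot p)
  have h := idealIndex_span_int p
  rw [idealIndex_eq_card, Nat.card_congr (IsLocalization.AtPrime.equivQuotMaximalIdeal
    (Ideal.span {(p : ℤ)}) (ZLoc p)).toEquiv, maximalIdeal_zLoc] at h
  exact h

theorem idealIndex_bot {D : Type*} [CommRing D] [CharZero D] : idealIndex (⊥ : Ideal D) = 0 := by
  have : Infinite D := Infinite.of_injective _ (Nat.cast_injective (R := D))
  exact AddSubgroup.index_bot.trans Nat.card_eq_zero_of_infinite

theorem isUnit_zLoc_of_not_dvd {x : ZLoc p} (h : ¬ (p : ZLoc p) ∣ x) : IsUnit x := by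
  rw [← Ideal.mem_span_singleton, ← maximalIdeal_zLoc, IsLocalRing.mem_maximalIdeal, mem_nonunits_iff,
    not_not] at h
  exact h

theorem exists_unit_of_bracket_eq {x : ZLoc p} {r : ℕ} (h : bracket p x = r) :
    ∃ u, IsUnit u ∧ x = (p : ZLoc p) ^ r * u := by
  obtain ⟨⟨u, rfl⟩, h2⟩ := emultiplicity_eq_coe.mp h
  refine ⟨u, isUnit_zLoc_of_not_dvd p fun hu => h2 ?_, rfl⟩
  rw [pow_succ]
  exact mul_dvd_mul_left _ hu

theorem ideal_zLoc_eq_span_pow {a : Ideal (ZLoc p)} (h : a ≠ ⊥) :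
    ∃ k, a = Ideal.span {(p : ZLoc p) ^ k} :=
  IsDiscreteValuationRing.ideal_eq_span_pow_irreducible h (prime_zLoc p).irreducible

theorem idealIndex_span_pow_zLoc (k : ℕ) : idealIndex (Ideal.span {(p : ZLoc p) ^ k}) = p ^ k := by
  rw [idealIndex_span_pow (prime_zLoc p).ne_zero, idealIndex_span_zLoc]

/-- The nonzero ideals are the powers of `(p)`: a geometric series. -/
theorem idealSum_zLoc (W : ℕ →*₀ ℝ≥0∞) : idealSum (ZLoc p) W = (1 - W p)⁻¹ := by
  have hinj : Function.Injective (fun k : ℕ => Ideal.span {(p : ZLoc p) ^ k}) := fun k l h => by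
    have := congrArg idealIndex h
    simp only [idealIndex_span_pow_zLoc] at this
    exact Nat.pow_right_injective hp.out.two_le this
  rw [idealSum, ← hinj.tsum_eq, ← ENNReal.tsum_geometric]
  · exact tsum_congr fun k => by rw [idealIndex_span_pow_zLoc, map_pow]
  · intro a ha
    have : a ≠ ⊥ := by
      rintro rfl
      exact ha (by simp [idealIndex_bot])
    obtain ⟨k, rfl⟩ := ideal_zLoc_eq_span_pow p this
    exact ⟨k, rfl⟩

theorem powWeight_lt_one {s : ℝ} (hs : 0 < s) : powWeight s hs p < 1 := by
  rw [powWeight_apply]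
  exact_mod_cast NNReal.rpow_lt_one_of_one_lt_of_neg (by exact_mod_cast hp.out.one_lt)
    (neg_neg_iff_pos.mpr hs)

theorem idealSum_zLoc_ne_top {s : ℝ} (hs : 0 < s) : idealSum (ZLoc p) (powWeight s hs) ≠ ⊤ := by
  rw [idealSum_zLoc, ENNReal.inv_ne_top]
  exact (tsub_pos_of_lt (powWeight_lt_one p hs)).ne'

theorem one_sub_mul_idealZeta_zLoc : (1 - dirichletMonomial p) * idealZeta (ZLoc p) = 1 := by
  refine eq_of_hasValue (σ := 0) (fun _ => 1) (fun s hs => ?_) (fun s _ => hasValue_one s)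
  refine (((hasValue_one s).sub (hasValue_dirichletMonomial hp.out.ne_zero s)).mul
    (hasValue_idealZeta hs (idealSum_zLoc_ne_top p hs))).congr ?_
  have h1 := powWeight_lt_one p hs
  have h2 : ((powWeight s hs p).toReal : ℝ) < 1 := by
    rw [← ENNReal.toReal_one]
    exact ENNReal.toReal_strict_mono ENNReal.one_ne_top h1
  rw [idealSum_zLoc, ← toReal_powWeight hs, ENNReal.toReal_inv,
    ENNReal.toReal_sub_of_le h1.le ENNReal.one_ne_top, ENNReal.toReal_one]
  have h3 : (1 - (powWeight s hs p).toReal : ℝ) ≠ 0 := by linarith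
  exact_mod_cast mul_inv_cancel₀ h3

theorem idealZeta_localCubicRing (α β : ℤ) (hα : bracket p (α : ZLoc p) = 1)
    (hβ : bracket p (β : ZLoc p) = 1) (hαβ : bracket p ((β : ZLoc p) - (α : ZLoc p)) = 2) :
    IdealZetaWellDefined (LocalCubicRing p α β) ∧
      idealZeta (LocalCubicRing p α β) =
        cubicNumerator (p : ArithmeticFunction ℤ) (dirichletMonomial p) *
          idealZeta (ZLoc p) ^ 3 ∧
      ∀ s : ℂ, 0 < s.re → LSeriesSummable (fun n => (idealZeta (LocalCubicRing p α β) n : ℂ)) s := by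
  obtain ⟨u, hu, hαu⟩ := exists_unit_of_bracket_eq p (r := 1) hα
  obtain ⟨w, hw, hβw⟩ := exists_unit_of_bracket_eq p (r := 1) hβ
  obtain ⟨v, hv, hv'⟩ := exists_unit_of_bracket_eq p (r := 2) hαβ
  rw [pow_one] at hαu hβw
  refine idealZeta_cubic idealIndex_bot (fun a ha => ?_) le_rfl
    (fun s hs _ => idealSum_zLoc_ne_top p hs) hu hv hw (prime_zLoc p)
    (by rw [← hv', hαu, hβw]) (idealIndex_span_zLoc p) Ideal.Quotient.mk_surjective ?_
  · obtain ⟨k, rfl⟩ := ideal_zLoc_eq_span_pow p ha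
    rw [idealIndex_span_pow_zLoc]
    exact pow_ne_zero _ hp.out.ne_zero
  · rw [Ideal.mk_ker, hαu, hβw, mul_assoc]

end Localized

/-! ### The base ring `ℤ` -/

section Integers

theorem ideal_int_eq_span_natCast (a : Ideal ℤ) : ∃ n : ℕ, a = Ideal.span {(n : ℤ)} := by
  refine ⟨(gen a).natAbs, ?_⟩
  rw [Int.span_natAbs, span_gen]

theorem idealIndex_int_ne_zero {a : Ideal ℤ} (ha : a ≠ ⊥) : idealIndex a ≠ 0 := by
  obtain ⟨n, rfl⟩ := ideal_int_eq_span_natCast a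
  rw [idealIndex_span_int]
  rintro rfl
  exact ha (by simp)

theorem idealSum_int (W : ℕ →*₀ ℝ≥0∞) : idealSum ℤ W = ∑' n, W n := by
  have hbij : Function.Bijective (fun n : ℕ => Ideal.span {(n : ℤ)}) :=
    ⟨fun m n h => by simpa only [idealIndex_span_int] using congrArg idealIndex h,
      fun a => (ideal_int_eq_span_natCast a).imp fun _ h => h.symm⟩
  rw [idealSum, ← (Equiv.ofBijective _ hbij).tsum_eq]
  exact tsum_congr fun n => congrArg W (idealIndex_span_int n)

theorem idealSum_int_ne_top {s : ℝ} (hs : 0 < s) (h : 1 < s) :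
    idealSum ℤ (powWeight s hs) ≠ ⊤ := by
  rw [idealSum_int]
  exact ENNReal.tsum_coe_ne_top_iff_summable.mpr (NNReal.summable_rpow.mpr (neg_lt_neg h))

theorem idealZeta_int : idealZeta ℤ = (ArithmeticFunction.zeta : ArithmeticFunction ℤ) := by
  ext n
  rcases eq_or_ne n 0 with rfl | hn
  · simp
  have h1 : idealZeta ℤ n = ((fullIdealsOfIndex ℤ n).ncard : ℤ) := if_neg hn
  have h2 : {I : Ideal ℤ | idealIndex I = n} = {Ideal.span {(n : ℤ)}} := by
    ext a
    obtain ⟨m, rfl⟩ := ideal_int_eq_span_natCast a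
    simp only [Set.mem_ofPred_eq, Set.mem_singleton_iff]
    exact ⟨fun h => by rw [← h, idealIndex_span_int],
      fun h => by rw [h, idealIndex_span_int]⟩
  rw [h1, fullIdealsOfIndex_eq hn, h2, Set.ncard_singleton]
  simp [hn]

theorem hasValue_zeta {s : ℂ} (hs : 1 < s.re) :
    HasValue (ArithmeticFunction.zeta : ArithmeticFunction ℤ) s (riemannZeta s) := by
  simpa [HasValue] using ArithmeticFunction.LSeriesHasSum_zeta hs

end Integers

/-! ### The 4-cycle -/

section FourCycle

/-- Evaluation of integral polynomials at a matrix. -/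
def evalMatrix {v : ℕ} (B : Matrix (Fin v) (Fin v) ℤ) : ℤ[X] →+* MatrixRing B :=
  (aeval (R := ℤ) (⟨B, Algebra.self_mem_adjoin_singleton ℤ B⟩ : Algebra.adjoin ℤ {B})).toRingHom

theorem coe_evalMatrix {v : ℕ} (B : Matrix (Fin v) (Fin v) ℤ) (f : ℤ[X]) :
    (evalMatrix B f : Matrix (Fin v) (Fin v) ℤ) = aeval B f := by
  exact (aeval_algHom_apply (Algebra.adjoin ℤ {B}).val _ f).symm

theorem evalMatrix_surjective {v : ℕ} (B : Matrix (Fin v) (Fin v) ℤ) :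
    Function.Surjective (evalMatrix B) := by
  rintro ⟨y, hy⟩
  have h := hy
  rw [Algebra.adjoin_singleton_eq_range_aeval] at h
  obtain ⟨f, hf⟩ := h
  exact ⟨f, Subtype.ext ((coe_evalMatrix B f).trans hf)⟩

theorem fourCycleMatrix_eq :
    fourCycleMatrix = !![0, 1, 0, 1; 1, 0, 1, 0; 0, 1, 0, 1; 1, 0, 1, 0] := by
  unfold fourCycleMatrix
  decide

theorem aeval_fourCycleMatrix :
    aeval fourCycleMatrix (X * ((X - C (2 * 1)) * (X - C (2 * -1))) : ℤ[X]) = 0 := by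
  have h : (X * ((X - C (2 * 1)) * (X - C (2 * -1))) : ℤ[X]) = X ^ 3 - 4 * X := by
    simp only [mul_neg, mul_one, C_neg, C_ofNat]
    ring
  rw [h, map_sub, map_mul, map_pow, aeval_X, fourCycleMatrix_eq, map_ofNat]
  decide

theorem ker_evalMatrix_fourCycle : RingHom.ker (evalMatrix fourCycleMatrix) =
    Ideal.span {X * ((X - C (2 * 1)) * (X - C (2 * -1)))} := by
  set g : ℤ[X] := X * ((X - C (2 * 1)) * (X - C (2 * -1))) with hg
  have hmonic : g.Monic := monic_X.mul ((monic_X_sub_C _).mul (monic_X_sub_C _))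
  have hdeg : g.natDegree = 3 := by
    rw [hg, monic_X.natDegree_mul ((monic_X_sub_C _).mul (monic_X_sub_C _)),
      (monic_X_sub_C _).natDegree_mul (monic_X_sub_C _), natDegree_X, natDegree_X_sub_C,
      natDegree_X_sub_C]
  have hmem (f : ℤ[X]) : f ∈ RingHom.ker (evalMatrix fourCycleMatrix) ↔
      aeval fourCycleMatrix f = 0 := by
    rw [RingHom.mem_ker, ← coe_evalMatrix]
    exact (ZeroMemClass.coe_eq_zero).symm
  ext f
  rw [hmem, Ideal.mem_span_singleton, ← modByMonic_eq_zero_iff_dvd hmonic]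
  have hsplit : aeval fourCycleMatrix f = aeval fourCycleMatrix (f %ₘ g) := by
    conv_lhs => rw [← modByMonic_add_div f g, map_add, map_mul, aeval_fourCycleMatrix,
      zero_mul, add_zero]
  rw [hsplit]
  refine ⟨fun h => ?_, fun h => by rw [h, map_zero]⟩
  have hlt : (f %ₘ g).natDegree < 3 := by
    have := natDegree_modByMonic_lt f hmonic (by rintro h; rw [h] at hdeg; simp at hdeg)
    rwa [hdeg] at this
  rw [aeval_eq_sum_range' hlt, Finset.sum_range_succ, Finset.sum_range_succ,
    Finset.sum_range_one, fourCycleMatrix_eq] at h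
  -- For `c₀ + c₁ B + c₂ B²` these entries are `c₀ + 2 c₂`, `c₁` and `2 c₂`, so a remainder of
  -- degree below `3` that kills `B` is zero.
  have h0 := congrFun (congrFun h 0) 0
  have h1 := congrFun (congrFun h 0) 1
  have h2 := congrFun (congrFun h 0) 2
  simp only [pow_zero, pow_one, sq, Matrix.add_apply, Matrix.smul_apply, Matrix.one_apply,
    Matrix.zero_apply, Matrix.mul_apply, Fin.sum_univ_four] at h0 h1 h2
  simp at h0 h1 h2
  rw [as_sum_range' _ 3 hlt, Finset.sum_range_succ, Finset.sum_range_succ, Finset.sum_range_one,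
    h1, h2, show (f %ₘ g).coeff 0 = 0 by simpa [h2] using h0]
  simp

theorem idealZeta_fourCycle :
    IdealZetaWellDefined (MatrixRing fourCycleMatrix) ∧
      idealZeta (MatrixRing fourCycleMatrix) =
        cubicNumerator (2 : ArithmeticFunction ℤ) (dirichletMonomial 2) *
          (ArithmeticFunction.zeta : ArithmeticFunction ℤ) ^ 3 ∧
      ∀ s : ℂ, 1 < s.re →
        LSeriesSummable (fun n => (idealZeta (MatrixRing fourCycleMatrix) n : ℂ)) s := by
  rw [← idealZeta_int]
  -- The eigenvalues `2`, `-2` are `π u`, `π w` with `π = 2`, `u = 1`, `w = -1`; their difference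
  -- `-4` forces `v = -1`.
  exact idealZeta_cubic idealIndex_bot (fun a ha => idealIndex_int_ne_zero ha) zero_le_one
    (fun s hs h => idealSum_int_ne_top hs h) isUnit_one (v := -1) isUnit_one.neg isUnit_one.neg
    Int.prime_two (by norm_num) (q := 2) (idealIndex_span_int 2)
    (evalMatrix_surjective fourCycleMatrix) ker_evalMatrix_fourCycle

end FourCycle

end

theorem proposition4p3 :
    -- the local zeta function, with `x = p^{-s}`
    (∀ (p : ℕ) [Fact p.Prime] (α β : ℤ),
      bracket p (α : ZLoc p) = 1 → bracket p (β : ZLoc p) = 1 →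
      bracket p ((β : ZLoc p) - (α : ZLoc p)) = 2 →
      IdealZetaWellDefined (LocalCubicRing p α β) ∧
      -- identity of formal Dirichlet series
      (∀ x : ArithmeticFunction ℤ, x = dirichletMonomial p →
        (1 - x) ^ 3 * idealZeta (LocalCubicRing p α β) =
          (p : ArithmeticFunction ℤ) ^ 4 * x ^ 8 - 2 * (p : ArithmeticFunction ℤ) ^ 3 * x ^ 7
          + ((p : ArithmeticFunction ℤ) ^ 3 + (p : ArithmeticFunction ℤ) ^ 2) * x ^ 6
          + ((p : ArithmeticFunction ℤ) ^ 3 - 2 * (p : ArithmeticFunction ℤ) ^ 2) * x ^ 5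
          + (p : ArithmeticFunction ℤ) * x ^ 4
          + ((p : ArithmeticFunction ℤ) ^ 2 - 2 * (p : ArithmeticFunction ℤ)) * x ^ 3
          + ((p : ArithmeticFunction ℤ) + 1) * x ^ 2 - 2 * x + 1) ∧
      -- identity of convergent series
      (∀ s : ℂ, 0 < s.re → ∀ x : ℂ, x = (p : ℂ) ^ (-s) →
        LSeriesSummable (fun n => (idealZeta (LocalCubicRing p α β) n : ℂ)) s ∧
        (1 - x) ^ 3 * LSeries (fun n => (idealZeta (LocalCubicRing p α β) n : ℂ)) s =
          (p : ℂ) ^ 4 * x ^ 8 - 2 * (p : ℂ) ^ 3 * x ^ 7 + ((p : ℂ) ^ 3 + (p : ℂ) ^ 2) * x ^ 6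
          + ((p : ℂ) ^ 3 - 2 * (p : ℂ) ^ 2) * x ^ 5 + (p : ℂ) * x ^ 4
          + ((p : ℂ) ^ 2 - 2 * (p : ℂ)) * x ^ 3 + ((p : ℂ) + 1) * x ^ 2 - 2 * x + 1)) ∧
    -- the case of the 4-cycle, with `x = 2^{-s}`
    (IdealZetaWellDefined (MatrixRing fourCycleMatrix) ∧
      (∀ x : ArithmeticFunction ℤ, x = dirichletMonomial 2 →
        idealZeta (MatrixRing fourCycleMatrix) =
          (16 * x ^ 8 - 16 * x ^ 7 + 12 * x ^ 6 + 2 * x ^ 4 + 3 * x ^ 2 - 2 * x + 1)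
            * (ArithmeticFunction.natToArithmeticFunction ArithmeticFunction.zeta :
                ArithmeticFunction ℤ) ^ 3) ∧
      (∀ s : ℂ, 1 < s.re → ∀ x : ℂ, x = (2 : ℂ) ^ (-s) →
        LSeriesSummable (fun n => (idealZeta (MatrixRing fourCycleMatrix) n : ℂ)) s ∧
        LSeries (fun n => (idealZeta (MatrixRing fourCycleMatrix) n : ℂ)) s =
          (16 * x ^ 8 - 16 * x ^ 7 + 12 * x ^ 6 + 2 * x ^ 4 + 3 * x ^ 2 - 2 * x + 1)
            * riemannZeta s ^ 3)) := by
  refine ⟨fun p _ α β hα hβ hαβ => ?_, ?_⟩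
  · obtain ⟨h1, h2, h3⟩ := idealZeta_localCubicRing p α β hα hβ hαβ
    have hp : p ≠ 0 := (Fact.out : p.Prime).ne_zero
    have h4 : (1 - dirichletMonomial p) ^ 3 * idealZeta (LocalCubicRing p α β) =
        cubicNumerator (p : ArithmeticFunction ℤ) (dirichletMonomial p) := by
      -- The factor `(1 - x) ^ 3` cancels the cube of the zeta function of `ℤ_(p)`.
      rw [h2, mul_left_comm, ← mul_pow, one_sub_mul_idealZeta_zLoc, one_pow, mul_one]
    refine ⟨h1, ?_, fun s hs x hx => ⟨h3 s hs, ?_⟩⟩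
    · rintro _ rfl
      exact h4
    · subst hx
      have h5 := (((hasValue_one s).sub (hasValue_dirichletMonomial hp s)).pow 3).mul
        (h3 s hs).LSeriesHasSum
      rw [h4] at h5
      exact h5.unique ((hasValue_natCast s p).cubicNumerator (hasValue_dirichletMonomial hp s))
  · obtain ⟨h1, h2, h3⟩ := idealZeta_fourCycle
    refine ⟨h1, ?_, fun s hs x hx => ⟨h3 s hs, ?_⟩⟩
    · rintro _ rfl
      rw [h2, cubicNumerator]
      ring
    · subst hx
      have h5 := ((hasValue_two s).cubicNumerator
        (hasValue_dirichletMonomial two_ne_zero s)).mul ((hasValue_zeta hs).pow 3)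
      rw [← h2] at h5
      rw [h5.LSeries_eq, cubicNumerator]
      push_cast
      ring
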